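/- Let $0<\lambda_1<1<\lambda_2$ with $\lambda_1\lambda_2<1$, and let $d_1,d_2\in\mathbb R$ be such that the maps $x\mapsto\lambda_1x+d_1$ and $x\mapsto\lambda_2x+d_2$ have no common fixed point. For $\varepsilon\in\mathbb R$ with $\lambda_1+\varepsilon>0$ and $(\lambda_1+\varepsilon)\lambda_2<1$, let $\mu_{\lambda_1+\varepsilon,\lambda_2}$ be the stationary measure of the iterated function system $f_1(x)=(\lambda_1+\varepsilon)x+d_1$, $f_2(x)=\lambda_2x+d_2$ with probabilities $(\frac12,\frac12)$, that is, the unique Borel probability measure $\mu$ on $\mathbb R$ with $\mu=\frac12(f_1)_*\mu+\frac12(f_2)_*\mu$ (it exists and is unique). Let $\nu=(\frac12,\frac12)^{\mathbb N}$ be the Bernoulli measure on $\Sigma=\{1,2\}^{\mathbb N}$. With $\lambda_1(\varepsilon)=\lambda_1+\varepsilon$ and $\lambda_2(\varepsilon)=\lambda_2$, put $$X(\varepsilon)(i_1,i_2,\dots)=\sum_{m=0}^{\infty}\lambda_{i_1}(\varepsilon)\cdots\lambda_{i_m}(\varepsilon)\,d_{i_{m+1}},\qquad X=X(0),\qquad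 X^{(j)}=\frac{d^j}{d\varepsilon^j}X(\varepsilon)\Big|_{\varepsilon=0}\quad(j\ge1).$$ For $\nu$-almost every word the series $X(\varepsilon)$ converges for all such $\varepsilon$, $\varepsilon\mapsto X(\varepsilon)$ is infinitely differentiable at $0$, and, for all $j\ge1$, $$X^{(j)}=\frac{j!}{\lambda_1^j}\sum_{m=0}^{\infty}\lambda_{i_1}\cdots\lambda_{i_m}\binom{o(m)}{j}\,d_{i_{m+1}},$$ where $o(m)$ is the number of $1$'s among $i_1,\dots,i_m$. Let $\varphi\in C_c^\infty(\mathbb R)$ be real-valued. Then $h(\varepsilon)=\int_{\mathbb R}\varphi\,d\mu_{\lambda_1+\varepsilon,\lambda_2}$ is infinitely differentiable at $0$ (that is, for every $n$ it is $C^n$ in a neighbourhood of $0$), and for every integer $l\ge0$ $$h^{(l)}(0)=\int_\Sigma\frac{d^l}{d\varepsilon^l}\,\varphi(X(\varepsilon))\Big|_{\varepsilon=0}\,d\nu=\int_\Sigma\ \sum_{k_1+2k_2+\cdots+lk_l=l}L(k_1,\dots,k_l)\,\varphi^{(k)}(X)\prod_{j=1}^{l}\bigl(X^{(j)}\bigr)^{k_j}\,d\nu,$$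 where both integrands are $\nu$-integrable, the sum is over all tuples of non-negative integers $(k_1,\dots,k_l)$ with $k_1+2k_2+\cdots+lk_l=l$, $k=k_1+\cdots+k_l$, and $$L(k_1,\dots,k_l)=\frac{l!}{k_1!\,(1!)^{k_1}\cdots k_l!\,(l!)^{k_l}}.$$ -/

import Mathlib

open MeasureTheory Finset
open scoped ContDiff ENNReal

namespace LinearResponse

noncomputable section

/-- The symbolic space of one-sided infinite words; the letters `1, 2` are the elements `0, 1` of
`Fin 2`, and the `m`-th letter of a word `w` (`m = 1, 2, …`) is `w (m - 1)`. -/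
abbrev Words : Type := ℕ → Fin 2

/-- The Bernoulli measure `(1/2, 1/2)^ℕ` on words. -/
def wordMeasure : Measure Words :=
  Measure.infinitePi fun _ : ℕ => (PMF.uniformOfFintype (Fin 2)).toMeasure

/-- `μ` is a stationary measure of the probabilistic iterated function system consisting of
`x ↦ lam i * x + d i`, `i = 0, 1`, each chosen with probability `1/2`. -/
def IsStationary (lam d : Fin 2 → ℝ) (μ : Measure ℝ) : Prop :=
  IsProbabilityMeasure μ ∧
    μ = ∑ i : Fin 2, (2⁻¹ : ℝ≥0∞) • μ.map (fun x => lam i * x + d i)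

open Classical in
/-- The stationary measure of the system (and the zero measure if there is none). -/
def stationaryMeasure (lam d : Fin 2 → ℝ) : Measure ℝ :=
  if h : ∃ μ, IsStationary lam d μ then h.choose else 0

/-- The contraction ratios `lam₁ + ε, lam₂` of the perturbed system. -/
def ratio (lam₁ lam₂ ε : ℝ) : Fin 2 → ℝ := ![lam₁ + ε, lam₂]

/-- The product of the ratios of the first `m` letters of `w`. -/
def wordRatio (lam : Fin 2 → ℝ) (w : Words) (m : ℕ) : ℝ := ∏ k ∈ range m, lam (w k)

/-- The symbolic projection: the sum over `m ≥ 0` of the product of the ratios of the first `m`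
letters, times the translation of the letter number `m + 1`. -/
def proj (lam d : Fin 2 → ℝ) (w : Words) : ℝ := ∑' m : ℕ, wordRatio lam w m * d (w m)

/-- The random variable `X(ε)`. -/
def X (lam₁ lam₂ : ℝ) (d : Fin 2 → ℝ) (ε : ℝ) (w : Words) : ℝ :=
  proj (ratio lam₁ lam₂ ε) d w

/-- `X^{(j)}`, the `j`-th derivative of `ε ↦ X(ε)` at `0`. -/
def XDeriv (lam₁ lam₂ : ℝ) (d : Fin 2 → ℝ) (j : ℕ) (w : Words) : ℝ :=
  iteratedDeriv j (fun ε => X lam₁ lam₂ d ε w) 0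

/-- The number of letters `1` (that is, `0 : Fin 2`) among the first `m` letters of `w`. -/
def onesCount (w : Words) (m : ℕ) : ℕ := #{k ∈ range m | w k = 0}

/-- The tuples `(k₁, …, k_l)` of natural numbers with `k₁ + 2 k₂ + ⋯ + l k_l = l`; the entry `k_j`
is the value at `j - 1`. (Every entry of such a tuple is at most `l`.) -/
def faaIndex (l : ℕ) : Finset (Fin l → ℕ) :=
  {k ∈ Fintype.piFinset fun _ : Fin l => range (l + 1) | ∑ j : Fin l, ((j : ℕ) + 1) * k j = l}

/-- The coefficient `l! / ∏_j k_j! (j!)^{k_j}`. -/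
def faaCoeff (l : ℕ) (k : Fin l → ℕ) : ℝ :=
  (l.factorial : ℝ) / ∏ j : Fin l, ((k j).factorial : ℝ) * (((j : ℕ) + 1).factorial : ℝ) ^ k j

/-- The formal derivative of order `l` of `φ(X(ε))` at `ε = 0`, by Faà di Bruno's formula. -/
def formalDeriv (lam₁ lam₂ : ℝ) (d : Fin 2 → ℝ) (φ : ℝ → ℝ) (l : ℕ) (w : Words) : ℝ :=
  ∑ k ∈ faaIndex l, faaCoeff l k * iteratedDeriv (∑ j, k j) φ (X lam₁ lam₂ d 0 w) *
    ∏ j : Fin l, XDeriv lam₁ lam₂ d ((j : ℕ) + 1) w ^ k j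

/-- `h(ε) = ∫ φ dμ_{lam₁ + ε, lam₂}`. -/
def response (lam₁ lam₂ : ℝ) (d : Fin 2 → ℝ) (φ : ℝ → ℝ) (ε : ℝ) : ℝ :=
  ∫ x, φ x ∂(stationaryMeasure (ratio lam₁ lam₂ ε) d)

end

end LinearResponse

/-! The stationary measure is the law of `X(ε)` under the Bernoulli measure, so `h(ε) = ∫ φ(X(ε))
dν` and the theorem is differentiation under the integral. Pathwise nothing is delicate: almost
surely the products `P_m` of the first `m` ratios decay geometrically, and they are monomials in `λ₁
+ ε`. So `X(ε)` is analytic and differentiable term by term, and Faà di Bruno's formula gives the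
integrand.

The difficulty is an integrable majorant: since `λ₂ > 1`, neither `X(ε)` nor its derivatives need
have moments. Contraction on average only gives `E[P_m^s] = θ^m` with `θ < 1` for some small `s >
0`, hence an integrable `V` with `P_m^s ≤ V q^m` (`exists_integrable_bound`).

Compact support of `φ` supplies the rest. The derivatives of `φ` vanish unless `X(ε)` is bounded,
and, as the maps share no fixed point, bounded `X(ε)` forces bounded `P_m` (`wordRatio_le_of_proj`):
the displacement of `X(ε)` from the fixed point of the expanding map is a nonzero constant times the
sum of `P_m` over the positions of the other letter. Interpolating the two bounds gives `P_m ≤ R V^t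
(q^t)^m` with `t = 1/(n+1)` (`le_mul_rpow_of_rpow_le`). Each derivative of `X(ε)` up to order `n` is
then `O(V^t)`, and the at most `n` factors of a Faà di Bruno term multiply to `O(V)`. As `P_m`
increases with `ε`, one `V`, taken at a slightly larger parameter, serves a whole neighbourhood of
`0` (`exists_dominating`). -/

namespace LinearResponse

noncomputable section

/-! ### Faà di Bruno's formula -/

/-- The formal Taylor series of a function at a point. -/
def taylorPS (f : ℝ → ℝ) (x : ℝ) : PowerSeries ℝ :=
  PowerSeries.mk fun n => iteratedDeriv n f x / n.factorial

theorem coeff_taylorPS (f : ℝ → ℝ) (x : ℝ) (n : ℕ) :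
    PowerSeries.coeff n (taylorPS f x) = iteratedDeriv n f x / n.factorial :=
  PowerSeries.coeff_mk _ _

/-- Leibniz's rule divided by `n!` is the Cauchy product. This turns derivatives of powers of a
function into coefficients of powers of a series. -/
theorem taylorPS_mul {f g : ℝ → ℝ} {x : ℝ} (hf : ContDiffAt ℝ ∞ f x) (hg : ContDiffAt ℝ ∞ g x) :
    taylorPS (fun y => f y * g y) x = taylorPS f x * taylorPS g x := by
  ext n
  rw [PowerSeries.coeff_mul, coeff_taylorPS,
    iteratedDeriv_fun_mul (hf.of_le (by exact_mod_cast le_top))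
      (hg.of_le (by exact_mod_cast le_top)),
    Finset.Nat.sum_antidiagonal_eq_sum_range_succ
      (fun i j => PowerSeries.coeff i (taylorPS f x) * PowerSeries.coeff j (taylorPS g x)),
    Finset.sum_div]
  refine Finset.sum_congr rfl fun i hi => ?_
  have hi' : i ≤ n := Nat.lt_succ_iff.mp (Finset.mem_range.mp hi)
  rw [coeff_taylorPS, coeff_taylorPS, Nat.cast_choose ℝ hi']
  have h1 : (i.factorial : ℝ) ≠ 0 := by positivity
  have h2 : ((n - i).factorial : ℝ) ≠ 0 := by positivity
  have h3 : (n.factorial : ℝ) ≠ 0 := by positivity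
  field_simp

theorem taylorPS_one (x : ℝ) : taylorPS (fun _ => 1) x = 1 := by
  ext n
  rw [coeff_taylorPS, iteratedDeriv_const, PowerSeries.coeff_one]
  split_ifs with h <;> simp [h]

theorem taylorPS_pow {f : ℝ → ℝ} {x : ℝ} (hf : ContDiffAt ℝ ∞ f x) (k : ℕ) :
    taylorPS (fun y => f y ^ k) x = taylorPS f x ^ k := by
  induction k with
  | zero => simpa using taylorPS_one x
  | succ k ih =>
    simp only [pow_succ]
    rw [taylorPS_mul (hf.pow k) hf, ih]

theorem taylorPS_id_sub (x : ℝ) : taylorPS (fun y => y - x) x = PowerSeries.X := by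
  ext n
  rw [coeff_taylorPS, PowerSeries.coeff_X]
  rcases n with _ | _ | n
  · simp
  · simp
  · have : deriv (fun y : ℝ => y - x) = fun _ => 1 := by
      ext y; simp
    rw [iteratedDeriv_succ', this, iteratedDeriv_const]
    simp

theorem iteratedDeriv_fun_sum_const_mul {ι : Type*} (s : Finset ι) (c : ι → ℝ) (f : ι → ℝ → ℝ)
    {x : ℝ} (hf : ∀ i ∈ s, ContDiffAt ℝ ∞ (f i) x) (n : ℕ) :
    iteratedDeriv n (fun y => ∑ i ∈ s, c i * f i y) x = ∑ i ∈ s, c i * iteratedDeriv n (f i) x := by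
  have hle : ((n : ℕ∞ω)) ≤ (∞ : ℕ∞ω) := by exact_mod_cast le_top
  rw [iteratedDeriv_fun_sum (fun i hi => contDiffAt_const.mul ((hf i hi).of_le hle))]
  refine Finset.sum_congr rfl fun i hi => ?_
  rw [← iteratedDeriv_const_mul _ ((hf i hi).of_le hle)]

/-- The derivative of order `n` of a composition depends only on the derivatives of order at most
`n` of the outer function. -/
theorem iteratedDeriv_comp_congr {g₁ g₂ f : ℝ → ℝ} {x : ℝ} (h₁ : ContDiffAt ℝ ∞ g₁ (f x))
    (h₂ : ContDiffAt ℝ ∞ g₂ (f x)) (hf : ContDiffAt ℝ ∞ f x) (n : ℕ)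
    (h : ∀ i ≤ n, iteratedDeriv i g₁ (f x) = iteratedDeriv i g₂ (f x)) :
    iteratedDeriv n (g₁ ∘ f) x = iteratedDeriv n (g₂ ∘ f) x := by
  have hle : ((n : ℕ∞ω)) ≤ (∞ : ℕ∞ω) := by exact_mod_cast le_top
  rw [iteratedDeriv_comp_eq_sum_orderedFinpartition (h₁.of_le hle) (hf.of_le hle) le_rfl,
    iteratedDeriv_comp_eq_sum_orderedFinpartition (h₂.of_le hle) (hf.of_le hle) le_rfl]
  refine Finset.sum_congr rfl fun c _ => ?_
  rw [h _ c.length_le]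

theorem iteratedDeriv_taylorPolynomial (a : ℕ → ℝ) (x : ℝ) {n i : ℕ} (hi : i ≤ n) :
    iteratedDeriv i (fun y => ∑ k ∈ range (n + 1), (a k / k.factorial) * (y - x) ^ k) x = a i := by
  rw [iteratedDeriv_fun_sum_const_mul _ (fun k => a k / k.factorial) (fun k y => (y - x) ^ k)
    (fun k _ => by fun_prop)]
  have key : ∀ k, iteratedDeriv i (fun y => (y - x) ^ k) x = if i = k then (i.factorial : ℝ) else 0 := by
    intro k
    have h := coeff_taylorPS (fun y => (y - x) ^ k) x i
    rw [taylorPS_pow (f := fun y => y - x) (by fun_prop), taylorPS_id_sub,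
      PowerSeries.coeff_X_pow] at h
    have h3 : (i.factorial : ℝ) ≠ 0 := by positivity
    rw [eq_div_iff h3] at h
    rw [← h]; split_ifs <;> simp
  simp only [key]
  rw [Finset.sum_eq_single i]
  · have h3 : (i.factorial : ℝ) ≠ 0 := by positivity
    simp only [if_true]; field_simp
  · intro b _ hb; simp [Ne.symm hb]
  · intro h; exact absurd (Finset.mem_range.mpr (by omega)) h

/-- The coefficient of order `l` of a power of a power series without constant term. -/
theorem coeff_pow_eq_sum_piAntidiag {U : PowerSeries ℝ} (hU : PowerSeries.coeff 0 U = 0)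
    (l k : ℕ) :
    PowerSeries.coeff l (U ^ k) =
      ∑ κ ∈ Finset.piAntidiag (univ : Finset (Fin l)) k with ∑ j : Fin l, ((j : ℕ) + 1) * κ j = l,
        (Nat.multinomial univ κ : ℝ) * ∏ j : Fin l, PowerSeries.coeff ((j : ℕ) + 1) U ^ κ j := by
  -- `A` truncates `U` to degrees `1, …, l`. The discarded part is divisible by `X ^ (l + 1)`, so it
  -- cannot affect the coefficient of order `l` of a power, and the multinomial theorem applies to
  -- the finite sum `A`.
  set A : PowerSeries ℝ := ∑ j : Fin l, PowerSeries.monomial ((j : ℕ) + 1)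
    (PowerSeries.coeff ((j : ℕ) + 1) U) with hA
  have hdvd : (PowerSeries.X : PowerSeries ℝ) ^ (l + 1) ∣ U - A := by
    rw [PowerSeries.X_pow_dvd_iff]
    intro m hm
    rw [map_sub, hA, map_sum]
    simp only [PowerSeries.coeff_monomial]
    rcases m with _ | m
    · simp [hU]
    · rw [Finset.sum_eq_single (⟨m, by omega⟩ : Fin l)]
      · simp
      · intro b _ hb
        rw [if_neg]
        intro h
        exact hb (Fin.ext (by simp; omega))
      · simp
  have hpow : PowerSeries.coeff l (U ^ k) = PowerSeries.coeff l (A ^ k) := by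
    have h := (PowerSeries.X_pow_dvd_iff.mp (hdvd.trans (sub_dvd_pow_sub_pow U A k))) l (by omega)
    rwa [map_sub, sub_eq_zero] at h
  have hprod : ∀ κ : Fin l → ℕ, ∏ j : Fin l, (PowerSeries.monomial ((j : ℕ) + 1)
      (PowerSeries.coeff ((j : ℕ) + 1) U)) ^ κ j =
      PowerSeries.monomial (∑ j : Fin l, ((j : ℕ) + 1) * κ j)
        (∏ j : Fin l, PowerSeries.coeff ((j : ℕ) + 1) U ^ κ j) := by
    intro κ
    simp only [PowerSeries.monomial_eq_C_mul_X_pow, mul_pow, ← pow_mul, Finset.prod_mul_distrib,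
      Finset.prod_pow_eq_pow_sum, map_prod, map_pow]
  rw [hpow, hA, Finset.sum_pow_eq_sum_piAntidiag, map_sum, Finset.sum_filter]
  refine Finset.sum_congr rfl fun κ _ => ?_
  rw [hprod, ← nsmul_eq_mul, map_nsmul, PowerSeries.coeff_monomial, nsmul_eq_mul]
  by_cases h : ∑ j : Fin l, ((j : ℕ) + 1) * κ j = l
  · rw [if_pos h, if_pos h.symm]
  · rw [if_neg h, if_neg (Ne.symm h), mul_zero]

theorem filter_faaIndex_eq (l k : ℕ) :
    {κ ∈ faaIndex l | ∑ j, κ j = k} =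
      {κ ∈ Finset.piAntidiag (univ : Finset (Fin l)) k | ∑ j : Fin l, ((j : ℕ) + 1) * κ j = l} := by
  ext κ
  simp only [faaIndex, Finset.mem_filter, Fintype.mem_piFinset, Finset.mem_range,
    Finset.mem_piAntidiag, Finset.mem_univ, implies_true, and_true]
  constructor
  · rintro ⟨⟨_, h2⟩, h3⟩; exact ⟨h3, h2⟩
  · rintro ⟨h3, h2⟩
    refine ⟨⟨fun j => ?_, h2⟩, h3⟩
    have := Finset.single_le_sum (f := fun j : Fin l => ((j : ℕ) + 1) * κ j) (fun _ _ => Nat.zero_le _)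
      (Finset.mem_univ j)
    simp only [h2] at this
    nlinarith [Nat.zero_le ((j : ℕ) * κ j)]

/-- Faà di Bruno's formula in terms of partitions of the integer `l`. -/
theorem iteratedDeriv_comp_eq_sum_faaIndex {g f : ℝ → ℝ} {x : ℝ} (hg : ContDiffAt ℝ ∞ g (f x))
    (hf : ContDiffAt ℝ ∞ f x) (l : ℕ) :
    iteratedDeriv l (fun y => g (f y)) x =
      ∑ k ∈ faaIndex l, faaCoeff l k * iteratedDeriv (∑ j, k j) g (f x) *
        ∏ j : Fin l, iteratedDeriv ((j : ℕ) + 1) f x ^ k j := by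
  have hfx : ContDiffAt ℝ ∞ (fun y => f y - f x) x := hf.sub contDiffAt_const
  set U := taylorPS (fun y => f y - f x) x with hU
  have hU0 : PowerSeries.coeff 0 U = 0 := by rw [hU, coeff_taylorPS]; simp
  have hUj : ∀ j : ℕ, PowerSeries.coeff (j + 1) U = iteratedDeriv (j + 1) f x / (j + 1).factorial := by
    intro j
    rw [hU, coeff_taylorPS, iteratedDeriv_succ', iteratedDeriv_succ']
    congr 2
    ext y; simp
  have hl : (l.factorial : ℝ) ≠ 0 := by positivity
  have h1 : iteratedDeriv l (fun y => g (f y)) x =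
      ∑ k ∈ range (l + 1), iteratedDeriv k g (f x) / k.factorial *
        (l.factorial * PowerSeries.coeff l (U ^ k)) := by
    -- Replacing `g` by its Taylor polynomial at `f x` leaves the derivative unchanged and reduces
    -- the formula to powers of `f - f x`, whose Taylor series are the `U ^ k`.
    have := iteratedDeriv_comp_congr (g₁ := g)
      (g₂ := fun y => ∑ k ∈ range (l + 1), (iteratedDeriv k g (f x) / k.factorial) * (y - f x) ^ k)
      (f := f) (x := x) hg (by fun_prop) hf l (fun i hi =>
        (iteratedDeriv_taylorPolynomial (fun k => iteratedDeriv k g (f x)) (f x) hi).symm)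
    have e : (fun y => g (f y)) = g ∘ f := rfl
    rw [e, this]
    have e2 : ((fun y => ∑ k ∈ range (l + 1), (iteratedDeriv k g (f x) / k.factorial) *
      (y - f x) ^ k) ∘ f) = fun y => ∑ k ∈ range (l + 1),
        (iteratedDeriv k g (f x) / k.factorial) * (f y - f x) ^ k := rfl
    rw [e2, iteratedDeriv_fun_sum_const_mul _ (fun k => iteratedDeriv k g (f x) / k.factorial)
      (fun k y => (f y - f x) ^ k) (fun k _ => hfx.pow k)]
    refine Finset.sum_congr rfl fun k _ => ?_
    rw [hU, ← taylorPS_pow hfx, coeff_taylorPS, mul_div_cancel₀ _ hl]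
  have hmaps : ∀ κ ∈ faaIndex l, ∑ j, κ j ∈ range (l + 1) := by
    intro κ hκ
    rw [faaIndex, Finset.mem_filter] at hκ
    rw [Finset.mem_range, Nat.lt_succ_iff]
    calc ∑ j, κ j ≤ ∑ j : Fin l, ((j : ℕ) + 1) * κ j :=
          Finset.sum_le_sum fun j _ => Nat.le_mul_of_pos_left _ (Nat.succ_pos _)
      _ = l := hκ.2
  rw [h1, ← Finset.sum_fiberwise_of_maps_to hmaps]
  refine Finset.sum_congr rfl fun k _ => ?_
  rw [coeff_pow_eq_sum_piAntidiag hU0, ← filter_faaIndex_eq, Finset.mul_sum, Finset.mul_sum]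
  refine Finset.sum_congr rfl fun κ hκ => ?_
  obtain ⟨hκ1, hκ2⟩ := Finset.mem_filter.mp hκ
  have hm : (Nat.multinomial univ κ : ℝ) = k.factorial / ∏ j : Fin l, ((κ j).factorial : ℝ) := by
    rw [eq_div_iff (by positivity), mul_comm, ← hκ2]
    exact_mod_cast Nat.multinomial_spec univ κ
  simp only [hUj, div_pow, Finset.prod_div_distrib]
  rw [hm, hκ2, faaCoeff, Finset.prod_mul_distrib]
  have a1 : (∏ j : Fin l, ((κ j).factorial : ℝ)) ≠ 0 := by positivity
  have a2 : (∏ j : Fin l, ((((j : ℕ) + 1).factorial : ℝ)) ^ κ j) ≠ 0 := by positivity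
  have a3 : (k.factorial : ℝ) ≠ 0 := by positivity
  field_simp

/-! ### Series of monomials with arbitrary exponents -/

theorem hasSum_choose_mul_pow (x y : ℝ) (n : ℕ) :
    HasSum (fun j : ℕ => (n.choose j : ℝ) * x ^ (n - j) * y ^ j) ((x + y) ^ n) := by
  have h : (x + y) ^ n = ∑ j ∈ range (n + 1), (n.choose j : ℝ) * x ^ (n - j) * y ^ j := by
    rw [add_comm, add_pow]
    exact Finset.sum_congr rfl fun j _ => by ring
  rw [h]
  refine hasSum_sum_of_ne_finset_zero fun j hj => ?_
  rw [Nat.choose_eq_zero_of_lt (by simpa using hj)]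
  simp

section MonomialSeries

variable {b : ℕ → ℝ} {o : ℕ → ℕ} {x r : ℝ}

/-- Binomial expansion of the nonnegative series at `x + r`. This absolute summability justifies
every exchange of sums below. -/
theorem summable_prod_choose (hx : 0 ≤ x) (hr : 0 ≤ r)
    (hs : Summable fun m => |b m| * (x + r) ^ o m) :
    Summable fun p : ℕ × ℕ => |b p.1| * ((o p.1).choose p.2 * x ^ (o p.1 - p.2) * r ^ p.2) := by
  rw [summable_prod_of_nonneg (fun p => by positivity)]
  have h : ∀ m, HasSum (fun j => |b m| * ((o m).choose j * x ^ (o m - j) * r ^ j))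
      (|b m| * (x + r) ^ o m) := fun m => (hasSum_choose_mul_pow x r (o m)).mul_left _
  exact ⟨fun m => (h m).summable, hs.congr fun m => (h m).tsum_eq.symm⟩

theorem summable_mul_choose (hx : 0 ≤ x) (hr : 0 < r)
    (hs : Summable fun m => |b m| * (x + r) ^ o m) (j : ℕ) :
    Summable fun m => b m * ((o m).choose j * x ^ (o m - j)) := by
  have h := ((summable_prod_choose hx hr.le hs).comp_injective
    (i := fun m : ℕ => (m, j)) (fun a b h => (Prod.ext_iff.mp h).1)).mul_right ((r ^ j)⁻¹)
  refine Summable.of_norm ?_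
  refine h.congr fun m => ?_
  have : r ^ j ≠ 0 := by positivity
  simp only [Function.comp]
  rw [Real.norm_eq_abs, abs_mul, abs_of_nonneg (a := ((o m).choose j : ℝ) * _) (by positivity)]
  field_simp

/-- Each monomial is recentred at `x` by the binomial theorem, and the two summations are exchanged.
-/
theorem hasFPowerSeriesOnBall_tsum_mul_pow (hx : 0 ≤ x) (hr : 0 < r)
    (hs : Summable fun m => |b m| * (x + r) ^ o m) :
    HasFPowerSeriesOnBall (fun y => ∑' m, b m * y ^ o m)
      (FormalMultilinearSeries.ofScalars ℝ
        fun j => ∑' m, b m * ((o m).choose j * x ^ (o m - j))) x (ENNReal.ofReal r) where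
  r_le := by
    refine FormalMultilinearSeries.le_radius_of_summable_norm _ (r := r.toNNReal) ?_
    have h := (summable_prod_choose hx hr.le hs).prod_symm.prod
    refine Summable.of_nonneg_of_le (fun j => by positivity) (fun j => ?_) h
    rw [FormalMultilinearSeries.ofScalars_norm, Real.coe_toNNReal _ hr.le, ← Real.norm_of_nonneg
      (show 0 ≤ r ^ j by positivity), ← norm_mul, ← tsum_mul_right]
    have hs' := (summable_prod_choose hx hr.le hs).prod_symm.prod_factor j
    refine (norm_tsum_le_tsum_norm ?_).trans_eq ?_
    · refine hs'.congr fun m => ?_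
      rw [Real.norm_eq_abs, abs_mul, abs_mul, abs_of_nonneg (a := ((o m).choose j : ℝ) * _)
        (by positivity), abs_of_nonneg (a := r ^ j) (by positivity)]
      simp [mul_assoc]
    · refine tsum_congr fun m => ?_
      rw [Real.norm_eq_abs, abs_mul, abs_mul, abs_of_nonneg (a := ((o m).choose j : ℝ) * _)
        (by positivity), abs_of_nonneg (a := r ^ j) (by positivity)]
      simp [mul_assoc]
  r_pos := by simpa using hr
  hasSum := by
    intro y hy
    have hy' : |y| < r := by
      rw [Metric.mem_eball, edist_zero_right, ← ofReal_norm,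
        ENNReal.ofReal_lt_ofReal_iff hr] at hy
      exact hy
    have hsum : Summable fun p : ℕ × ℕ =>
        b p.1 * ((o p.1).choose p.2 * x ^ (o p.1 - p.2) * y ^ p.2) := by
      refine Summable.of_norm_bounded (summable_prod_choose hx hr.le hs) fun p => ?_
      rw [Real.norm_eq_abs, abs_mul, abs_mul, abs_of_nonneg (a := ((o p.1).choose p.2 : ℝ) * _)
        (by positivity), abs_pow]
      gcongr
    have h1 := hsum.hasSum.prod_fiberwise fun m =>
      (hasSum_choose_mul_pow x y (o m)).mul_left (b m)
    have h2 := hsum.prod_symm.hasSum.prod_fiberwise fun j => (hsum.prod_symm.prod_factor j).hasSum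
    have h3 : ∑' p : ℕ × ℕ, b p.1 * ((o p.1).choose p.2 * x ^ (o p.1 - p.2) * y ^ p.2) =
        ∑' p : ℕ × ℕ, b p.swap.1 * ((o p.swap.1).choose p.swap.2 *
          x ^ (o p.swap.1 - p.swap.2) * y ^ p.swap.2) :=
      ((Equiv.prodComm ℕ ℕ).tsum_eq (fun p : ℕ × ℕ =>
        b p.1 * ((o p.1).choose p.2 * x ^ (o p.1 - p.2) * y ^ p.2))).symm
    rw [h1.tsum_eq, h3]
    refine h2.congr_fun fun j => ?_
    rw [FormalMultilinearSeries.ofScalars_apply_eq, smul_eq_mul, ← tsum_mul_right]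
    exact tsum_congr fun m => by simp [mul_assoc]

theorem analyticAt_tsum_mul_pow (hx : 0 ≤ x) (hr : 0 < r)
    (hs : Summable fun m => |b m| * (x + r) ^ o m) :
    AnalyticAt ℝ (fun y => ∑' m, b m * y ^ o m) x :=
  (hasFPowerSeriesOnBall_tsum_mul_pow hx hr hs).analyticAt

theorem hasSum_iteratedDeriv_tsum_mul_pow (hx : 0 ≤ x) (hr : 0 < r)
    (hs : Summable fun m => |b m| * (x + r) ^ o m) (j : ℕ) :
    HasSum (fun m => (j.factorial : ℝ) * (b m * ((o m).choose j * x ^ (o m - j))))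
      (iteratedDeriv j (fun y => ∑' m, b m * y ^ o m) x) := by
  have h := (hasFPowerSeriesOnBall_tsum_mul_pow hx hr hs).factorial_smul 1 j
  rw [iteratedDeriv_eq_iteratedFDeriv, ← h, FormalMultilinearSeries.ofScalars_apply_eq]
  simpa using (summable_mul_choose hx hr hs j).hasSum.mul_left (j.factorial : ℝ)

end MonomialSeries

/-! ### Smoothness of parametric integrals -/

theorem differentiableAt_iteratedDeriv {f : ℝ → ℝ} {x : ℝ} (hf : ContDiffAt ℝ ∞ f x) (n : ℕ) :
    DifferentiableAt ℝ (iteratedDeriv n f) x := by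
  have h := ContDiffWithinAt.differentiableWithinAt_iteratedDerivWithin (m := n)
    (contDiffWithinAt_univ.mpr hf) (by exact_mod_cast ENat.natCast_lt_top n)
    (by simp)
  rwa [iteratedDerivWithin_univ, differentiableWithinAt_univ] at h

section ParametricIntegral

variable {Ω : Type*} [MeasurableSpace Ω] {μ : Measure Ω} {F : ℝ → Ω → ℝ} {U : Set ℝ}

/-- Each derivative is an almost everywhere limit of difference quotients of the previous one along
a fixed sequence of steps. -/
theorem aestronglyMeasurable_iteratedDeriv (hU : IsOpen U)
    (hm : ∀ x ∈ U, AEStronglyMeasurable (F x) μ)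
    (hd : ∀ᵐ w ∂μ, ∀ x ∈ U, ContDiffAt ℝ ∞ (F · w) x) (n : ℕ) :
    ∀ x ∈ U, AEStronglyMeasurable (fun w => iteratedDeriv n (F · w) x) μ := by
  induction n with
  | zero => simpa using hm
  | succ n ih =>
    intro x hx
    obtain ⟨δ, hδ, hball⟩ := Metric.isOpen_iff.mp hU x hx
    -- With `k + 2` the step is strictly below `δ` already at `k = 0`, so the shifted point stays in
    -- the ball.
    have hu : Filter.Tendsto (fun k : ℕ => δ / ((k : ℝ) + 2)) Filter.atTop (nhdsWithin 0 {0}ᶜ) := by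
      refine tendsto_nhdsWithin_iff.mpr ⟨?_, Filter.Eventually.of_forall fun k => ?_⟩
      · exact tendsto_const_nhds.div_atTop
          (Filter.tendsto_atTop_add_const_right _ _ tendsto_natCast_atTop_atTop)
      · have : δ / ((k : ℝ) + 2) ≠ 0 := by positivity
        exact this
    refine aestronglyMeasurable_of_tendsto_ae (u := Filter.atTop)
      (f := fun (k : ℕ) w => (δ / ((k : ℝ) + 2))⁻¹ •
        (iteratedDeriv n (F · w) (x + δ / ((k : ℝ) + 2)) - iteratedDeriv n (F · w) x))
      (fun k => ?_) ?_
    · refine ((ih _ (hball ?_)).sub (ih x hx)).const_smul (δ / ((k : ℝ) + 2))⁻¹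
      rw [Metric.mem_ball, Real.dist_eq, add_sub_cancel_left, abs_of_pos (by positivity)]
      exact div_lt_self hδ (by linarith [(Nat.cast_nonneg k : (0 : ℝ) ≤ k)])
    · filter_upwards [hd] with w hw
      have h := (differentiableAt_iteratedDeriv (hw x hx) n).hasDerivAt
      rw [iteratedDeriv_succ]
      exact (hasDerivAt_iff_tendsto_slope_zero.mp h).comp hu

variable (hU : IsOpen U) (hm : ∀ x ∈ U, AEStronglyMeasurable (F x) μ)
  (hd : ∀ᵐ w ∂μ, ∀ x ∈ U, ContDiffAt ℝ ∞ (F · w) x)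
  (hb : ∀ n : ℕ, ∃ g : Ω → ℝ, Integrable g μ ∧ ∀ᵐ w ∂μ, ∀ x ∈ U, |iteratedDeriv n (F · w) x| ≤ g w)

include hU hm hd hb

theorem integrable_iteratedDeriv (n : ℕ) {x : ℝ} (hx : x ∈ U) :
    Integrable (fun w => iteratedDeriv n (F · w) x) μ := by
  obtain ⟨g, hg, hgb⟩ := hb n
  exact hg.mono' (aestronglyMeasurable_iteratedDeriv hU hm hd n x hx) (hgb.mono fun w hw => hw x hx)

theorem hasDerivAt_integral_iteratedDeriv (n : ℕ) {x : ℝ} (hx : x ∈ U) :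
    HasDerivAt (fun y => ∫ w, iteratedDeriv n (F · w) y ∂μ)
      (∫ w, iteratedDeriv (n + 1) (F · w) x ∂μ) x := by
  obtain ⟨g, hg, hgb⟩ := hb (n + 1)
  refine (hasDerivAt_integral_of_dominated_loc_of_deriv_le (hU.mem_nhds hx)
    (F := fun y w => iteratedDeriv n (F · w) y) (F' := fun y w => iteratedDeriv (n + 1) (F · w) y)
    ?_ (integrable_iteratedDeriv hU hm hd hb n hx)
    (aestronglyMeasurable_iteratedDeriv hU hm hd (n + 1) x hx) hgb hg ?_).2
  · filter_upwards [hU.mem_nhds hx] with y hy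
    exact aestronglyMeasurable_iteratedDeriv hU hm hd n y hy
  · filter_upwards [hd] with w hw y hy
    rw [iteratedDeriv_succ]
    exact (differentiableAt_iteratedDeriv (hw y hy) n).hasDerivAt

theorem iteratedDeriv_integral (n : ℕ) : ∀ x ∈ U,
    iteratedDeriv n (fun y => ∫ w, F y w ∂μ) x = ∫ w, iteratedDeriv n (F · w) x ∂μ := by
  induction n with
  | zero => simp
  | succ n ih =>
    intro x hx
    rw [iteratedDeriv_succ]
    refine ((hasDerivAt_integral_iteratedDeriv hU hm hd hb n hx).congr_of_eventuallyEq ?_).deriv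
    filter_upwards [hU.mem_nhds hx] with y hy using ih y hy

theorem contDiffOn_integral : ContDiffOn ℝ ∞ (fun y => ∫ w, F y w ∂μ) U := by
  refine contDiffOn_of_differentiableOn_deriv fun n _ => ?_
  intro x hx
  refine (hasDerivAt_integral_iteratedDeriv hU hm hd hb n hx).differentiableAt.differentiableWithinAt.congr
    (fun y hy => ?_) ?_
  · rw [iteratedDerivWithin_of_isOpen hU hy, iteratedDeriv_integral hU hm hd hb n y hy]
  · rw [iteratedDerivWithin_of_isOpen hU hx, iteratedDeriv_integral hU hm hd hb n x hx]

end ParametricIntegral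

/-! ### The Bernoulli measure -/

instance : IsProbabilityMeasure wordMeasure := by
  unfold wordMeasure; infer_instance

/-- Put a letter in front of a word. -/
def consWord (i : Fin 2) (w : Words) : Words
  | 0 => i
  | n + 1 => w n

@[simp] theorem consWord_zero (i : Fin 2) (w : Words) : consWord i w 0 = i := rfl

@[simp] theorem consWord_succ (i : Fin 2) (w : Words) (n : ℕ) : consWord i w (n + 1) = w n := rfl

theorem measurable_consWord (i : Fin 2) : Measurable (consWord i) := by
  refine measurable_pi_lambda _ fun n => ?_
  cases n with
  | zero => exact measurable_const
  | succ n => exact measurable_pi_apply n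

theorem uniform_apply (s : Set (Fin 2)) :
    (PMF.uniformOfFintype (Fin 2)).toMeasure s =
      ∑ i : Fin 2, 2⁻¹ * s.indicator (fun _ => (1 : ℝ≥0∞)) i := by
  classical
  rw [PMF.toMeasure_apply_fintype]
  refine Finset.sum_congr rfl fun i _ => ?_
  by_cases h : i ∈ s <;> simp [h, PMF.uniformOfFintype_apply]

/-- The first letter is uniform and independent of the shifted word, which has the same law; this is
checked on cylinders by shifting coordinates. Later inductions on word length rest on this
self-similarity. -/
theorem wordMeasure_eq_sum :
    wordMeasure = ∑ i : Fin 2, (2⁻¹ : ℝ≥0∞) • wordMeasure.map (consWord i) := by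
  classical
  symm
  refine Measure.eq_infinitePi _ fun s t ht => ?_
  set p := (PMF.uniformOfFintype (Fin 2)).toMeasure
  have hmeas : MeasurableSet (Set.pi (s : Set ℕ) t) :=
    MeasurableSet.pi s.countable_toSet fun i _ => ht i
  set s' : Finset ℕ := s.preimage Nat.succ Nat.succ_injective.injOn with hs'
  have hpre : ∀ i : Fin 2, consWord i ⁻¹' (Set.pi (s : Set ℕ) t) =
      {w | 0 ∈ s → i ∈ t 0} ∩ Set.pi (s' : Set ℕ) fun n => t (n + 1) := by
    intro i
    ext w
    simp only [Set.mem_preimage, Set.mem_pi, Set.mem_inter_iff, Set.mem_ofPred_eq, hs',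
      Finset.mem_coe, Finset.mem_preimage]
    constructor
    · exact fun h => ⟨fun h0 => h 0 h0, fun n hn => h (n + 1) hn⟩
    · rintro ⟨h0, h1⟩ (_ | n) hn
      · exact h0 hn
      · exact h1 n hn
  have hpi : wordMeasure (Set.pi (s' : Set ℕ) fun n => t (n + 1)) = ∏ n ∈ s', p (t (n + 1)) :=
    Measure.infinitePi_pi _ fun i _ => ht _
  have himg : ∏ n ∈ s', p (t (n + 1)) = ∏ n ∈ s.erase 0, p (t n) := by
    refine Finset.prod_bij (fun n _ => n + 1) (fun n hn => ?_) (fun _ _ _ _ h => Nat.succ_injective h)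
      (fun n hn => ?_) (fun _ _ => rfl)
    · simpa [hs'] using hn
    · obtain ⟨h0, h1⟩ := Finset.mem_erase.mp hn
      obtain ⟨k, rfl⟩ := Nat.exists_eq_succ_of_ne_zero h0
      exact ⟨k, by simpa [hs'] using h1, rfl⟩
  rw [Measure.finsetSum_apply]
  simp only [Measure.smul_apply, smul_eq_mul, Measure.map_apply (measurable_consWord _) hmeas, hpre]
  by_cases h0 : 0 ∈ s
  · have : ∀ i : Fin 2, wordMeasure ({w | 0 ∈ s → i ∈ t 0} ∩ Set.pi (s' : Set ℕ) fun n => t (n + 1))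
        = (t 0).indicator (fun _ => (1 : ℝ≥0∞)) i * ∏ n ∈ s.erase 0, p (t n) := by
      intro i
      by_cases hi : i ∈ t 0
      · simp [hi, hpi, himg]
      · simp [hi, h0]
    simp only [this, ← mul_assoc]
    rw [← Finset.sum_mul, ← uniform_apply, Finset.mul_prod_erase s (fun n => p (t n)) h0]
  · have h1 : s.erase 0 = s := Finset.erase_eq_of_notMem h0
    simp only [h0, false_imp_iff, Set.ofPred_true, Set.univ_inter, hpi, himg, h1]
    rw [← Finset.sum_mul]
    simp [ENNReal.mul_inv_cancel]

theorem lintegral_wordMeasure_eq_sum {f : Words → ℝ≥0∞} (hf : Measurable f) :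
    ∫⁻ w, f w ∂wordMeasure = ∑ i : Fin 2, 2⁻¹ * ∫⁻ w, f (consWord i w) ∂wordMeasure := by
  conv_lhs => rw [wordMeasure_eq_sum]
  rw [lintegral_finsetSum_measure]
  simp only [lintegral_smul_measure, smul_eq_mul, lintegral_map hf (measurable_consWord _)]

theorem map_consWord_absolutelyContinuous (i : Fin 2) :
    wordMeasure.map (consWord i) ≪ wordMeasure := by
  refine Measure.AbsolutelyContinuous.mk fun s _ h => ?_
  rw [wordMeasure_eq_sum, Measure.finsetSum_apply, Finset.sum_eq_zero_iff] at h
  simpa using h i (Finset.mem_univ i)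

/-! ### Products of ratios -/

theorem measurable_wordRatio (lam : Fin 2 → ℝ) (m : ℕ) :
    Measurable fun w => wordRatio lam w m := by
  unfold wordRatio
  exact Finset.measurable_prod _ fun k _ => (Measurable.of_discrete (f := lam)).comp
    (measurable_pi_apply k)

@[simp] theorem wordRatio_zero (lam : Fin 2 → ℝ) (w : Words) : wordRatio lam w 0 = 1 := by
  simp [wordRatio]

theorem wordRatio_succ (lam : Fin 2 → ℝ) (w : Words) (m : ℕ) :
    wordRatio lam w (m + 1) = wordRatio lam w m * lam (w m) := by
  simp [wordRatio, Finset.prod_range_succ]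

theorem wordRatio_consWord_succ (lam : Fin 2 → ℝ) (i : Fin 2) (w : Words) (m : ℕ) :
    wordRatio lam (consWord i w) (m + 1) = lam i * wordRatio lam w m := by
  simp [wordRatio, Finset.prod_range_succ', mul_comm]

theorem wordRatio_pos {lam : Fin 2 → ℝ} (hlam : ∀ i, 0 < lam i) (w : Words) (m : ℕ) :
    0 < wordRatio lam w m := Finset.prod_pos fun _ _ => hlam _

theorem wordRatio_mono {lam lam' : Fin 2 → ℝ} (hlam : ∀ i, 0 < lam i) (h : ∀ i, lam i ≤ lam' i)
    (w : Words) (m : ℕ) : wordRatio lam w m ≤ wordRatio lam' w m :=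
  Finset.prod_le_prod (fun _ _ => (hlam _).le) fun _ _ => h _

/-- A system that contracts on average has a moment of small order that contracts. -/
theorem exists_moment_lt_one {lam : Fin 2 → ℝ} (hlam : ∀ i, 0 < lam i) (hprod : lam 0 * lam 1 < 1) :
    ∃ s : ℝ, 0 < s ∧ s ≤ 1 ∧ (lam 0 ^ s + lam 1 ^ s) / 2 < 1 := by
  -- At `s = 0` the sum equals `2` and its derivative is `log (lam 0 * lam 1) < 0`, so it drops
  -- below `2` for small `s > 0`.
  have hd : HasDerivAt (fun s : ℝ => lam 0 ^ s + lam 1 ^ s) (Real.log (lam 0 * lam 1)) 0 := by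
    have h := (Real.hasStrictDerivAt_const_rpow (hlam 0) 0).hasDerivAt.add
      (Real.hasStrictDerivAt_const_rpow (hlam 1) 0).hasDerivAt
    rw [Real.log_mul (hlam 0).ne' (hlam 1).ne']
    simpa [Pi.add_def] using h
  have hneg : Real.log (lam 0 * lam 1) < 0 := Real.log_neg (mul_pos (hlam 0) (hlam 1)) hprod
  have h1 := (hasDerivAt_iff_tendsto_slope_zero.mp hd).eventually (gt_mem_nhds hneg)
  have h2 : ∀ᶠ s : ℝ in nhdsWithin 0 (Set.Ioi 0),
      s⁻¹ • ((lam 0 ^ (0 + s) + lam 1 ^ (0 + s)) - (lam 0 ^ (0 : ℝ) + lam 1 ^ (0 : ℝ))) < 0 :=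
    h1.filter_mono (nhdsWithin_mono _ fun s hs => (Set.mem_Ioi.mp hs).ne')
  have h3 : ∀ᶠ s : ℝ in nhdsWithin 0 (Set.Ioi 0), s < 1 :=
    nhdsWithin_le_nhds (gt_mem_nhds one_pos)
  obtain ⟨s, ⟨h4, h5⟩, h6⟩ := ((h2.and h3).and self_mem_nhdsWithin).exists
  have h6 : 0 < s := h6
  refine ⟨s, h6, h5.le, ?_⟩
  simp only [zero_add, Real.rpow_zero, smul_eq_mul] at h4
  have := (pos_iff_neg_of_mul_neg h4).mp (inv_pos.mpr h6)
  linarith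

theorem lintegral_wordRatio_rpow {lam : Fin 2 → ℝ} (hlam : ∀ i, 0 < lam i) (s : ℝ) (m : ℕ) :
    ∫⁻ w, ENNReal.ofReal (wordRatio lam w m ^ s) ∂wordMeasure =
      ENNReal.ofReal (((lam 0 ^ s + lam 1 ^ s) / 2) ^ m) := by
  have hmeas : ∀ m, Measurable fun w => ENNReal.ofReal (wordRatio lam w m ^ s) := fun m =>
    ((measurable_wordRatio lam m).pow_const s).ennreal_ofReal
  have h0 := hlam 0
  have h1 := hlam 1
  induction m with
  | zero => simp
  | succ m ih =>
    rw [lintegral_wordMeasure_eq_sum (hmeas _)]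
    have : ∀ i w, ENNReal.ofReal (wordRatio lam (consWord i w) (m + 1) ^ s) =
        ENNReal.ofReal (lam i ^ s) * ENNReal.ofReal (wordRatio lam w m ^ s) := by
      intro i w
      rw [wordRatio_consWord_succ, Real.mul_rpow (hlam i).le (wordRatio_pos hlam w m).le,
        ENNReal.ofReal_mul (Real.rpow_nonneg (hlam i).le s)]
    simp only [this, lintegral_const_mul _ (hmeas m), ih, Fin.sum_univ_two]
    rw [← ENNReal.ofReal_mul (by positivity), ← ENNReal.ofReal_mul (by positivity), ← mul_add,
      ← ENNReal.ofReal_add (by positivity) (by positivity), pow_succ,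
      show (2 : ℝ≥0∞)⁻¹ = ENNReal.ofReal 2⁻¹ by rw [ENNReal.ofReal_inv_of_pos two_pos]; simp,
      ← ENNReal.ofReal_mul (by positivity)]
    congr 1; ring

/-- Products of ratios decay exponentially, with an integrable constant. -/
theorem exists_integrable_bound {lam : Fin 2 → ℝ} (hlam : ∀ i, 0 < lam i)
    (hprod : lam 0 * lam 1 < 1) :
    ∃ s q : ℝ, ∃ V : Words → ℝ, 0 < s ∧ s ≤ 1 ∧ 0 < q ∧ q < 1 ∧ Integrable V wordMeasure ∧
      ∀ᵐ w ∂wordMeasure, 1 ≤ V w ∧ ∀ m, wordRatio lam w m ^ s ≤ V w * q ^ m := by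
  obtain ⟨s, hs0, hs1, hθ⟩ := exists_moment_lt_one hlam hprod
  set θ := (lam 0 ^ s + lam 1 ^ s) / 2 with hθdef
  have hθ0 : 0 < θ := by
    have := hlam 0; have := hlam 1; positivity
  obtain ⟨q, hq1, hq2⟩ := exists_between hθ
  have hq0 : 0 < q := hθ0.trans hq1
  -- Since `θ < q`, the sum of `q ^ (-m) P_m ^ s` has expectation `∑ (θ / q) ^ m < ∞`. It dominates
  -- each of its terms; `V` is this sum plus `1`.
  set G : ℕ → Words → ℝ≥0∞ := fun m w =>
    ENNReal.ofReal ((q ^ m)⁻¹) * ENNReal.ofReal (wordRatio lam w m ^ s) with hG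
  have hGm : ∀ m, Measurable (G m) := fun m =>
    (((measurable_wordRatio lam m).pow_const s).ennreal_ofReal).const_mul _
  have hint : ∫⁻ w, ∑' m, G m w ∂wordMeasure ≠ ⊤ := by
    rw [lintegral_tsum fun m => (hGm m).aemeasurable]
    have : ∀ m, ∫⁻ w, G m w ∂wordMeasure = ENNReal.ofReal ((θ / q) ^ m) := by
      intro m
      rw [hG, lintegral_const_mul _ (((measurable_wordRatio lam m).pow_const s).ennreal_ofReal),
        lintegral_wordRatio_rpow hlam, ← ENNReal.ofReal_mul (by positivity), ← hθdef, div_pow θ q, div_eq_inv_mul]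
    simp only [this]
    rw [← ENNReal.ofReal_tsum_of_nonneg (fun m => by positivity)
      (summable_geometric_of_lt_one (by positivity) ((div_lt_one hq0).mpr hq1))]
    exact ENNReal.ofReal_ne_top
  have hVm : Measurable fun w => ∑' m, G m w := Measurable.tsum hGm
  refine ⟨s, q, fun w => (∑' m, G m w).toReal + 1, hs0, hs1, hq0, hq2,
    (integrable_toReal_of_lintegral_ne_top hVm.aemeasurable hint).add (integrable_const 1), ?_⟩
  filter_upwards [ae_lt_top hVm hint] with w hw
  have h0 : 0 ≤ (∑' m, G m w).toReal := ENNReal.toReal_nonneg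
  refine ⟨by linarith, fun m => ?_⟩
  have h1 : G m w ≤ ∑' m, G m w := ENNReal.le_tsum m
  have h2 := ENNReal.toReal_mono hw.ne h1
  have hp : 0 ≤ wordRatio lam w m ^ s := Real.rpow_nonneg (wordRatio_pos hlam w m).le s
  rw [hG] at h2
  simp only [ENNReal.toReal_mul, ENNReal.toReal_ofReal hp,
    ENNReal.toReal_ofReal (show 0 ≤ (q ^ m)⁻¹ by positivity)] at h2
  have hqm : 0 < q ^ m := by positivity
  rw [inv_mul_le_iff₀ hqm] at h2
  nlinarith

/-- The products of ratios along the word `w` decay exponentially. -/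
def HasGeometricDecay (lam : Fin 2 → ℝ) (w : Words) : Prop :=
  ∃ C q : ℝ, 0 ≤ C ∧ 0 < q ∧ q < 1 ∧ ∀ m, wordRatio lam w m ≤ C * q ^ m

theorem ae_hasGeometricDecay {lam : Fin 2 → ℝ} (hlam : ∀ i, 0 < lam i)
    (hprod : lam 0 * lam 1 < 1) : ∀ᵐ w ∂wordMeasure, HasGeometricDecay lam w := by
  obtain ⟨s, q, V, hs0, -, hq0, hq1, -, hV⟩ := exists_integrable_bound hlam hprod
  filter_upwards [hV] with w ⟨hV1, hV2⟩
  have hV0 : 0 ≤ V w := zero_le_one.trans hV1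
  refine ⟨V w ^ s⁻¹, q ^ s⁻¹, by positivity, by positivity,
    Real.rpow_lt_one hq0.le hq1 (by positivity), fun m => ?_⟩
  have h := Real.rpow_le_rpow (Real.rpow_nonneg (wordRatio_pos hlam w m).le s) (hV2 m)
    (inv_nonneg.mpr hs0.le)
  rw [Real.rpow_rpow_inv (wordRatio_pos hlam w m).le hs0.ne',
    Real.mul_rpow hV0 (by positivity)] at h
  rwa [← Real.rpow_natCast q m, ← Real.rpow_mul hq0.le, mul_comm (m : ℝ), Real.rpow_mul hq0.le,
    Real.rpow_natCast] at h

theorem HasGeometricDecay.mono {lam lam' : Fin 2 → ℝ} {w : Words} (h : HasGeometricDecay lam' w)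
    (hlam : ∀ i, 0 < lam i) (hle : ∀ i, lam i ≤ lam' i) : HasGeometricDecay lam w := by
  obtain ⟨C, q, h1, h2, h3, h4⟩ := h
  exact ⟨C, q, h1, h2, h3, fun m => (wordRatio_mono hlam hle w m).trans (h4 m)⟩

theorem HasGeometricDecay.summable {lam : Fin 2 → ℝ} {w : Words} (h : HasGeometricDecay lam w)
    (hlam : ∀ i, 0 < lam i) : Summable (wordRatio lam w) := by
  obtain ⟨C, q, h1, h2, h3, h4⟩ := h
  exact Summable.of_nonneg_of_le (fun m => (wordRatio_pos hlam w m).le) h4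
    ((summable_geometric_of_lt_one h2.le h3).mul_left C)

theorem summable_mul_of_summable_wordRatio {lam : Fin 2 → ℝ} {w : Words}
    (h : Summable (wordRatio lam w)) (hlam : ∀ i, 0 < lam i) (c : Fin 2 → ℝ) :
    Summable fun m => wordRatio lam w m * c (w m) := by
  refine Summable.of_norm_bounded (h.mul_right (∑ i, |c i|)) fun m => ?_
  rw [Real.norm_eq_abs, abs_mul, abs_of_pos (wordRatio_pos hlam w m)]
  gcongr
  · exact (wordRatio_pos hlam w m).le
  · exact Finset.single_le_sum (f := fun i => |c i|) (fun _ _ => abs_nonneg _) (Finset.mem_univ _)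

/-! ### The stationary measure -/

theorem ae_summable_wordRatio {lam : Fin 2 → ℝ} (hlam : ∀ i, 0 < lam i)
    (hprod : lam 0 * lam 1 < 1) : ∀ᵐ w ∂wordMeasure, Summable (wordRatio lam w) :=
  (ae_hasGeometricDecay hlam hprod).mono fun _ hw => hw.summable hlam

/-- The finite sums defining the symbolic projection. -/
def partialProj (lam d : Fin 2 → ℝ) (w : Words) (n : ℕ) : ℝ :=
  ∑ m ∈ range n, wordRatio lam w m * d (w m)

theorem measurable_partialProj (lam d : Fin 2 → ℝ) (n : ℕ) :
    Measurable fun w => partialProj lam d w n := by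
  unfold partialProj
  exact Finset.measurable_sum _ fun k _ => (measurable_wordRatio lam k).mul
    ((Measurable.of_discrete (f := d)).comp (measurable_pi_apply k))

theorem partialProj_consWord_succ (lam d : Fin 2 → ℝ) (i : Fin 2) (w : Words) (n : ℕ) :
    partialProj lam d (consWord i w) (n + 1) = lam i * partialProj lam d w n + d i := by
  simp only [partialProj, Finset.sum_range_succ', wordRatio_consWord_succ, consWord_succ,
    wordRatio_zero, consWord_zero, one_mul, Finset.mul_sum, mul_assoc]

theorem tendsto_partialProj {lam : Fin 2 → ℝ} (hlam : ∀ i, 0 < lam i) (d : Fin 2 → ℝ) {w : Words}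
    (hw : Summable (wordRatio lam w)) :
    Filter.Tendsto (partialProj lam d w) Filter.atTop (nhds (proj lam d w)) :=
  (summable_mul_of_summable_wordRatio hw hlam d).hasSum.tendsto_sum_nat

theorem aemeasurable_proj {lam : Fin 2 → ℝ} (hlam : ∀ i, 0 < lam i)
    (hprod : lam 0 * lam 1 < 1) (d : Fin 2 → ℝ) : AEMeasurable (proj lam d) wordMeasure :=
  aemeasurable_of_tendsto_metrizable_ae Filter.atTop
    (fun n => (measurable_partialProj lam d n).aemeasurable)
    ((ae_summable_wordRatio hlam hprod).mono fun _ hw => tendsto_partialProj hlam d hw)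

theorem proj_consWord {lam : Fin 2 → ℝ} (hlam : ∀ i, 0 < lam i) (d : Fin 2 → ℝ) {w : Words}
    (hw : Summable (wordRatio lam w)) (i : Fin 2) :
    proj lam d (consWord i w) = lam i * proj lam d w + d i := by
  have h1 := summable_mul_of_summable_wordRatio hw hlam d
  have h2 : HasSum (fun m => wordRatio lam (consWord i w) (m + 1) * d (consWord i w (m + 1)))
      (lam i * proj lam d w) := by
    simpa only [wordRatio_consWord_succ, consWord_succ, mul_assoc, proj] using h1.hasSum.mul_left (lam i)
  have h3 := (hasSum_nat_add_iff (f := fun m => wordRatio lam (consWord i w) m * d (consWord i w m))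
    1).mp h2
  simpa [proj] using h3.tsum_eq

/-- The projection intertwines prepending the letter `i` with the `i`-th map, so the self-similarity
of the Bernoulli measure pushes forward to stationarity. -/
theorem isStationary_map_proj {lam : Fin 2 → ℝ} (hlam : ∀ i, 0 < lam i)
    (hprod : lam 0 * lam 1 < 1) (d : Fin 2 → ℝ) :
    IsStationary lam d (wordMeasure.map (proj lam d)) := by
  have hm := aemeasurable_proj hlam hprod d
  refine ⟨Measure.isProbabilityMeasure_map hm, ?_⟩
  -- The projection is only known to be almost everywhere measurable, so its measurability must be
  -- transferred along absolute continuity.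
  have hmi : ∀ i, AEMeasurable (proj lam d) (wordMeasure.map (consWord i)) := fun i =>
    hm.mono_ac (map_consWord_absolutelyContinuous i)
  have key : ∀ i : Fin 2, (wordMeasure.map (consWord i)).map (proj lam d) =
      (wordMeasure.map (proj lam d)).map fun x => lam i * x + d i := by
    intro i
    rw [AEMeasurable.map_map_of_aemeasurable (hmi i) (measurable_consWord i).aemeasurable,
      AEMeasurable.map_map_of_aemeasurable (by fun_prop) hm]
    refine Measure.map_congr ?_
    filter_upwards [ae_summable_wordRatio hlam hprod] with w hw using proj_consWord hlam d hw i
  ext t ht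
  conv_lhs => rw [wordMeasure_eq_sum]
  rw [Measure.map_apply_of_aemeasurable (by rw [← wordMeasure_eq_sum]; exact hm) ht,
    Measure.finsetSum_apply, Measure.finsetSum_apply]
  refine Finset.sum_congr rfl fun i _ => ?_
  rw [Measure.smul_apply, Measure.smul_apply, ← key i,
    Measure.map_apply_of_aemeasurable (hmi i) ht]

theorem IsStationary.lintegral_eq_sum {lam d : Fin 2 → ℝ} {μ : Measure ℝ}
    (h : IsStationary lam d μ) {f : ℝ → ℝ≥0∞} (hf : Measurable f) :
    ∫⁻ x, f x ∂μ = ∑ i : Fin 2, 2⁻¹ * ∫⁻ x, f (lam i * x + d i) ∂μ := by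
  conv_lhs => rw [h.2]
  rw [lintegral_finsetSum_measure]
  refine Finset.sum_congr rfl fun i _ => ?_
  rw [lintegral_smul_measure, lintegral_map hf (by fun_prop), smul_eq_mul]

/-- The inner argument is the composition of the first `n` maps of the word applied to `x`;
stationarity is used once per letter. -/
theorem IsStationary.lintegral_iterate {lam d : Fin 2 → ℝ} {μ : Measure ℝ}
    (h : IsStationary lam d μ) (n : ℕ) {f : ℝ → ℝ≥0∞} (hf : Measurable f) :
    ∫⁻ w, ∫⁻ x, f (partialProj lam d w n + wordRatio lam w n * x) ∂μ ∂wordMeasure =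
      ∫⁻ x, f x ∂μ := by
  have := h.1
  induction n generalizing f with
  | zero => simp [partialProj]
  | succ n ih =>
    rw [lintegral_wordMeasure_eq_sum, h.lintegral_eq_sum hf]
    · refine Finset.sum_congr rfl fun i _ => ?_
      rw [← ih (f := fun x => f (lam i * x + d i)) (by fun_prop)]
      congr! 6 with w x
      rw [partialProj_consWord_succ, wordRatio_consWord_succ]
      ring
    · refine Measurable.lintegral_prod_right'
        (f := fun p : Words × ℝ => f (partialProj lam d p.1 (n + 1) + wordRatio lam p.1 (n + 1) * p.2)) ?_
      exact hf.comp (((measurable_partialProj lam d _).comp measurable_fst).add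
        (((measurable_wordRatio lam _).comp measurable_fst).mul measurable_snd))

/-- Along almost every word the composed maps converge pointwise to the constant `proj lam d w`,
because the products of ratios tend to `0`. Bounded continuous test functions then identify the
measure. -/
theorem IsStationary.eq_map_proj {lam d : Fin 2 → ℝ} (hlam : ∀ i, 0 < lam i)
    (hprod : lam 0 * lam 1 < 1) {μ : Measure ℝ} (h : IsStationary lam d μ) :
    μ = wordMeasure.map (proj lam d) := by
  have := h.1
  have hm := aemeasurable_proj hlam hprod d
  have := Measure.isProbabilityMeasure_map hm
  refine ext_of_forall_lintegral_eq_of_IsFiniteMeasure fun ψ => ?_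
  have hψ : Measurable fun x => (ψ x : ℝ≥0∞) := ψ.continuous.measurable.coe_nnreal_ennreal
  have hψb : ∀ x, (ψ x : ℝ≥0∞) ≤ (nndist ψ 0 : ℝ≥0∞) := fun x => by
    exact_mod_cast BoundedContinuousFunction.NNReal.upper_bound ψ x
  have hc : Continuous fun x => (ψ x : ℝ≥0∞) := ENNReal.continuous_coe.comp ψ.continuous
  have hconst : ∫⁻ _, (nndist ψ 0 : ℝ≥0∞) ∂μ ≠ ⊤ := by simp
  rw [lintegral_map' hψ.aemeasurable hm]
  refine tendsto_nhds_unique (f := fun n : ℕ => ∫⁻ w, ∫⁻ x,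
    (ψ (partialProj lam d w n + wordRatio lam w n * x) : ℝ≥0∞) ∂μ ∂wordMeasure) (l := Filter.atTop)
    (tendsto_const_nhds.congr fun n => (h.lintegral_iterate n hψ).symm) ?_
  refine tendsto_lintegral_of_dominated_convergence (fun _ => (nndist ψ 0 : ℝ≥0∞)) (fun n => ?_)
    (fun n => Filter.Eventually.of_forall fun w => ?_) (by simp) ?_
  · refine Measurable.lintegral_prod_right'
      (f := fun p : Words × ℝ => (ψ (partialProj lam d p.1 n + wordRatio lam p.1 n * p.2) : ℝ≥0∞)) ?_
    exact hψ.comp (((measurable_partialProj lam d _).comp measurable_fst).add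
      (((measurable_wordRatio lam _).comp measurable_fst).mul measurable_snd))
  · exact (lintegral_mono fun x => hψb _).trans_eq (by simp)
  · filter_upwards [ae_summable_wordRatio hlam hprod] with w hw
    have hlim : ∫⁻ _, (ψ (proj lam d w) : ℝ≥0∞) ∂μ = ψ (proj lam d w) := by simp
    rw [← hlim]
    refine tendsto_lintegral_of_dominated_convergence (fun _ => (nndist ψ 0 : ℝ≥0∞))
      (fun n => hψ.comp (by fun_prop)) (fun n => Filter.Eventually.of_forall fun x => hψb _) hconst
      (Filter.Eventually.of_forall fun x => ?_)
    refine (hc.tendsto _).comp ?_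
    simpa using (tendsto_partialProj hlam d hw).add (hw.tendsto_atTop_zero.mul_const x)

theorem stationaryMeasure_eq_map_proj {lam : Fin 2 → ℝ} (hlam : ∀ i, 0 < lam i)
    (hprod : lam 0 * lam 1 < 1) (d : Fin 2 → ℝ) :
    stationaryMeasure lam d = wordMeasure.map (proj lam d) := by
  have h : ∃ μ, IsStationary lam d μ := ⟨_, isStationary_map_proj hlam hprod d⟩
  rw [stationaryMeasure, dif_pos h]
  exact h.choose_spec.eq_map_proj hlam hprod

/-! ### The random variables `X(ε)` and their derivatives -/

theorem onesCount_le (w : Words) (m : ℕ) : onesCount w m ≤ m := by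
  simpa [onesCount] using Finset.card_filter_le (range m) (fun k => w k = 0)

theorem wordRatio_ratio (lam₁ lam₂ ε : ℝ) (w : Words) (m : ℕ) :
    wordRatio (ratio lam₁ lam₂ ε) w m =
      lam₂ ^ (m - onesCount w m) * (lam₁ + ε) ^ onesCount w m := by
  have h : ∀ i : Fin 2, ratio lam₁ lam₂ ε i = if i = 0 then lam₁ + ε else lam₂ := by
    intro i; fin_cases i <;> simp [ratio]
  have hc : #{k ∈ range m | ¬ w k = 0} = m - onesCount w m := by
    have := Finset.card_filter_add_card_filter_not (s := range m) (fun k => w k = 0)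
    rw [Finset.card_range] at this
    rw [onesCount]; omega
  rw [wordRatio, Finset.prod_congr rfl fun k _ => h (w k), Finset.prod_ite, Finset.prod_const,
    Finset.prod_const, hc, mul_comm, onesCount]

theorem ratio_pos {lam₁ lam₂ ε : ℝ} (h₁ : 0 < lam₁ + ε) (h₂ : 0 < lam₂) (i : Fin 2) :
    0 < ratio lam₁ lam₂ ε i := by
  fin_cases i <;> simpa [ratio]

theorem ratio_le {lam₁ lam₂ ε ε' : ℝ} (h : ε ≤ ε') (i : Fin 2) :
    ratio lam₁ lam₂ ε i ≤ ratio lam₁ lam₂ ε' i := by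
  fin_cases i <;> simp [ratio, h]

section XDerivatives

variable {lam₁ lam₂ ε ε' : ℝ} {d : Fin 2 → ℝ} {w : Words}

theorem X_eq_tsum (w : Words) :
    (fun ε => X lam₁ lam₂ d ε w) = fun ε =>
      (fun y => ∑' m, lam₂ ^ (m - onesCount w m) * d (w m) * y ^ onesCount w m) (lam₁ + ε) := by
  funext ε
  simp only [X, proj, wordRatio_ratio]
  exact tsum_congr fun m => by ring

/-- Summability at the larger parameter `ε'` provides a radius of convergence `ε' - ε` around `ε`.
-/
theorem summable_abs_mul_pow (h₂ : 0 < lam₂) (hε : 0 < lam₁ + ε) (hlt : ε < ε')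
    (hw : Summable (wordRatio (ratio lam₁ lam₂ ε') w)) :
    Summable fun m => |lam₂ ^ (m - onesCount w m) * d (w m)| *
      ((lam₁ + ε) + (ε' - ε)) ^ onesCount w m := by
  have hpos := ratio_pos (show 0 < lam₁ + ε' by linarith) h₂
  refine (summable_mul_of_summable_wordRatio hw hpos fun i => |d i|).congr fun m => ?_
  rw [wordRatio_ratio, abs_mul, abs_of_pos (pow_pos h₂ _), show lam₁ + ε + (ε' - ε) = lam₁ + ε' by ring]
  ring

theorem contDiffAt_X (h₂ : 0 < lam₂) (hε : 0 < lam₁ + ε) (hlt : ε < ε')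
    (hw : Summable (wordRatio (ratio lam₁ lam₂ ε') w)) :
    ContDiffAt ℝ ∞ (fun ε => X lam₁ lam₂ d ε w) ε := by
  rw [X_eq_tsum]
  have h := (analyticAt_tsum_mul_pow hε.le (sub_pos.mpr hlt)
    (summable_abs_mul_pow (d := d) h₂ hε hlt hw)).contDiffAt (n := ∞)
  exact ContDiffAt.comp (g := fun y => ∑' m, lam₂ ^ (m - onesCount w m) * d (w m) * y ^ onesCount w m)
    (f := fun ε => lam₁ + ε) ε h (by fun_prop)

theorem hasSum_iteratedDeriv_X (h₂ : 0 < lam₂) (hε : 0 < lam₁ + ε) (hlt : ε < ε')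
    (hw : Summable (wordRatio (ratio lam₁ lam₂ ε') w)) (j : ℕ) :
    HasSum (fun m => (j.factorial : ℝ) / (lam₁ + ε) ^ j *
        (wordRatio (ratio lam₁ lam₂ ε) w m * ((onesCount w m).choose j : ℝ) * d (w m)))
      (iteratedDeriv j (fun ε => X lam₁ lam₂ d ε w) ε) := by
  have h := hasSum_iteratedDeriv_tsum_mul_pow hε.le (sub_pos.mpr hlt)
    (summable_abs_mul_pow (d := d) h₂ hε hlt hw) j
  rw [X_eq_tsum, iteratedDeriv_comp_const_add j (fun y =>
    ∑' m, lam₂ ^ (m - onesCount w m) * d (w m) * y ^ onesCount w m) lam₁]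
  refine h.congr_fun fun m => ?_
  rw [wordRatio_ratio]
  rcases le_or_gt j (onesCount w m) with hj | hj
  · rw [← pow_sub_mul_pow (lam₁ + ε) hj]
    field_simp
  · simp [Nat.choose_eq_zero_of_lt hj]

/-- The binomial coefficient is at most `m ^ j`, which geometric decay absorbs. Linearity in `B`
matters: `B` will carry the random factor `V ^ t`. -/
theorem abs_iteratedDeriv_X_le (h₂ : 0 < lam₂) {a : ℝ} (ha : 0 < a) (hε : a ≤ lam₁ + ε)
    (hlt : ε < ε') (hw : Summable (wordRatio (ratio lam₁ lam₂ ε') w)) {B q : ℝ} (hq0 : 0 < q)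
    (hq1 : q < 1) (hB : ∀ m, wordRatio (ratio lam₁ lam₂ ε) w m ≤ B * q ^ m) (j : ℕ) :
    |iteratedDeriv j (fun ε => X lam₁ lam₂ d ε w) ε| ≤
      (j.factorial : ℝ) / a ^ j * (∑' m : ℕ, (m : ℝ) ^ j * q ^ m) * (∑ i, |d i|) * B := by
  have hε0 : 0 < lam₁ + ε := ha.trans_le hε
  have hgeo : Summable fun m : ℕ => (m : ℝ) ^ j * q ^ m :=
    summable_pow_mul_geometric_of_norm_lt_one j (by rwa [Real.norm_of_nonneg hq0.le])
  have h1 := hasSum_iteratedDeriv_X (d := d) h₂ hε0 hlt hw j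
  have h2 := ((hgeo.hasSum.mul_left ((j.factorial : ℝ) / a ^ j)).mul_right (∑ i, |d i|)).mul_right B
  rw [← h1.tsum_eq, ← Real.norm_eq_abs]
  refine tsum_of_norm_bounded h2 fun m => ?_
  have hP := wordRatio_pos (ratio_pos (ε := ε) hε0 h₂) w m
  have hd : |d (w m)| ≤ ∑ i, |d i| :=
    Finset.single_le_sum (f := fun i => |d i|) (fun _ _ => abs_nonneg _) (Finset.mem_univ _)
  have hc : (((onesCount w m).choose j : ℕ) : ℝ) ≤ (m : ℝ) ^ j := by
    calc (((onesCount w m).choose j : ℕ) : ℝ) ≤ ((onesCount w m ^ j : ℕ) : ℝ) := by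
          exact_mod_cast Nat.choose_le_pow _ _
      _ ≤ (m : ℝ) ^ j := by
          push_cast
          gcongr
          exact_mod_cast onesCount_le w m
  rw [Real.norm_eq_abs, abs_mul, abs_mul, abs_mul, abs_of_pos hP, Nat.abs_cast,
    abs_of_pos (show 0 < (j.factorial : ℝ) / (lam₁ + ε) ^ j by positivity)]
  calc (j.factorial : ℝ) / (lam₁ + ε) ^ j * (wordRatio (ratio lam₁ lam₂ ε) w m *
        ((onesCount w m).choose j : ℝ) * |d (w m)|)
      ≤ (j.factorial : ℝ) / a ^ j * ((B * q ^ m) * (m : ℝ) ^ j * (∑ i, |d i|)) := by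
        gcongr
        · exact mul_nonneg (hP.le.trans (hB m)) (by positivity)
        · exact hP.le.trans (hB m)
        · exact hB m
    _ = _ := by ring

end XDerivatives

/-! ### Bounds on products of ratios in terms of the symbolic projection -/

section ProjBound

variable {lam d : Fin 2 → ℝ} {w : Words}

/-- With `p = d 1 / (1 - lam 1)`, the telescoping identity `∑ (P_m - P_{m+1}) = 1` gives `p - proj`
as the sum of `P_m (p (1 - lam i) - d i)`, `i = w m`. The bracket vanishes for the expanding letter
because `p` is its fixed point. -/
theorem hasSum_indicator_wordRatio (hlam : ∀ i, 0 < lam i) (h1 : 1 < lam 1)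
    (hw : Summable (wordRatio lam w)) :
    HasSum (fun m => (d 1 / (1 - lam 1) * (1 - lam 0) - d 0) *
        (wordRatio lam w m * (![1, 0] : Fin 2 → ℝ) (w m)))
      (d 1 / (1 - lam 1) - proj lam d w) := by
  have hne : 1 - lam 1 ≠ 0 := by linarith
  have hP := hw.hasSum
  have hP1 : HasSum (fun m => wordRatio lam w (m + 1)) ((∑' m, wordRatio lam w m) - 1) := by
    have := (hasSum_nat_add_iff' 1).mpr hP
    simpa using this
  have h := ((hP.sub hP1).mul_left (d 1 / (1 - lam 1))).sub
    (summable_mul_of_summable_wordRatio hw hlam d).hasSum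
  have e : d 1 / (1 - lam 1) * (∑' m, wordRatio lam w m - (∑' m, wordRatio lam w m - 1)) -
      ∑' m, wordRatio lam w m * d (w m) = d 1 / (1 - lam 1) - proj lam d w := by
    rw [proj]; ring
  rw [e] at h
  refine h.congr_fun fun m => ?_
  rw [wordRatio_succ]
  generalize w m = i
  fin_cases i
  · simp; ring
  · simp; field_simp; ring

/-- If the two maps of the system have no common fixed point, the products of ratios are controlled
by the distance of the projection to the fixed point of the expanding map. -/
theorem wordRatio_le_of_proj (hlam : ∀ i, 0 < lam i) (h1 : 1 < lam 1)
    (hw : Summable (wordRatio lam w)) (hc : d 1 / (1 - lam 1) * (1 - lam 0) - d 0 ≠ 0) (m : ℕ) :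
    wordRatio lam w m ≤
      |d 1 / (1 - lam 1) - proj lam d w| / |d 1 / (1 - lam 1) * (1 - lam 0) - d 0| := by
  set c := d 1 / (1 - lam 1) * (1 - lam 0) - d 0 with hcdef
  set B := |d 1 / (1 - lam 1) - proj lam d w| / |c| with hB
  have hnn : ∀ m, 0 ≤ wordRatio lam w m * (![1, 0] : Fin 2 → ℝ) (w m) := by
    intro m
    refine mul_nonneg (wordRatio_pos hlam w m).le ?_
    generalize w m = i
    fin_cases i <;> simp
  have hsum : HasSum (fun m => wordRatio lam w m * (![1, 0] : Fin 2 → ℝ) (w m))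
      ((d 1 / (1 - lam 1) - proj lam d w) / c) := by
    have := (hasSum_indicator_wordRatio (d := d) hlam h1 hw).mul_left c⁻¹
    rw [div_eq_inv_mul]
    exact this.congr_fun fun m => by rw [inv_mul_cancel_left₀ hc]
  have hzero : ∀ m, w m = 0 → wordRatio lam w m ≤ B := by
    intro m hm
    have h := le_hasSum hsum m fun i _ => hnn i
    rw [hm] at h
    simp only [Matrix.cons_val_zero, mul_one] at h
    exact h.trans ((le_abs_self _).trans_eq (abs_div _ _))
  by_contra! hlt
  -- Once a product exceeds `B`, the letter `0` can no longer occur, so the products never decrease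
  -- again, contradicting their convergence to `0`.
  have hstay : ∀ k, wordRatio lam w m ≤ wordRatio lam w (m + k) := by
    intro k
    induction k with
    | zero => exact le_rfl
    | succ k ih =>
      have hk : w (m + k) = 1 := by
        by_contra hne
        have : w (m + k) = 0 := by omega
        exact absurd (hzero _ this) (not_le.mpr (hlt.trans_le ih))
      rw [← add_assoc, wordRatio_succ, hk]
      exact ih.trans (le_mul_of_one_le_right (wordRatio_pos hlam w _).le h1.le)
  have hlim : Filter.Tendsto (fun k => wordRatio lam w (m + k)) Filter.atTop (nhds 0) := by
    have := (Filter.tendsto_add_atTop_iff_nat m).mpr hw.tendsto_atTop_zero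
    simpa only [add_comm] using this
  exact absurd (ge_of_tendsto' hlim hstay) (not_le.mpr (wordRatio_pos hlam w m))

end ProjBound

/-- Since `P / R ≤ 1`, lowering its exponent from `1` to `s / p` only increases it. The a priori
bound `R` thus buys the small power `1 / p` of `v`. -/
theorem le_mul_rpow_of_rpow_le {P R s v q : ℝ} (hP : 0 < P) (hPR : P ≤ R) (hR : 1 ≤ R) (hs0 : 0 < s)
    (hs1 : s ≤ 1) (hv : 0 ≤ v) (hq : 0 ≤ q) {m : ℕ} (h : P ^ s ≤ v * q ^ m) {p : ℕ} (hp : 1 ≤ p) :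
    P ≤ R * v ^ (p : ℝ)⁻¹ * (q ^ (p : ℝ)⁻¹) ^ m := by
  have hp' : (1 : ℝ) ≤ p := by exact_mod_cast hp
  have hR0 : 0 < R := zero_lt_one.trans_le hR
  have hexp : s * (p : ℝ)⁻¹ ≤ 1 := mul_le_one₀ hs1 (by positivity) (inv_le_one_of_one_le₀ hp')
  have h1 : P / R ≤ P ^ (s * (p : ℝ)⁻¹) := by
    have hle : P / R ≤ 1 := (div_le_one hR0).mpr hPR
    calc P / R = (P / R) ^ (1 : ℝ) := (Real.rpow_one _).symm
      _ ≤ (P / R) ^ (s * (p : ℝ)⁻¹) :=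
          Real.rpow_le_rpow_of_exponent_ge (by positivity) hle hexp
      _ ≤ P ^ (s * (p : ℝ)⁻¹) :=
          Real.rpow_le_rpow (by positivity) (div_le_self hP.le hR) (by positivity)
  have h2 : P ^ (s * (p : ℝ)⁻¹) ≤ v ^ (p : ℝ)⁻¹ * (q ^ (p : ℝ)⁻¹) ^ m := by
    rw [Real.rpow_mul hP.le, ← Real.rpow_natCast (q ^ (p : ℝ)⁻¹) m, ← Real.rpow_mul hq,
      mul_comm (p : ℝ)⁻¹ (m : ℝ), Real.rpow_mul hq, Real.rpow_natCast,
      ← Real.mul_rpow hv (by positivity)]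
    exact Real.rpow_le_rpow (by positivity) h (by positivity)
  rw [div_le_iff₀ hR0] at h1
  calc P ≤ P ^ (s * (p : ℝ)⁻¹) * R := h1
    _ ≤ (v ^ (p : ℝ)⁻¹ * (q ^ (p : ℝ)⁻¹) ^ m) * R := by gcongr
    _ = _ := by ring

/-! ### Test functions and compositions -/

theorem exists_bound_iteratedDeriv {φ : ℝ → ℝ} (hφ : ContDiff ℝ ∞ φ) (hφc : HasCompactSupport φ)
    (n : ℕ) : ∃ C, 0 ≤ C ∧ ∀ k ≤ n, ∀ y, |iteratedDeriv k φ y| ≤ C := by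
  have h : ∀ k, ∃ C, ∀ y, |iteratedDeriv k φ y| ≤ C := by
    intro k
    obtain ⟨C, hC⟩ := (hφ.continuous_iteratedFDeriv (m := k)
      (by exact_mod_cast le_top)).bounded_above_of_compact_support (hφc.iteratedFDeriv k)
    exact ⟨C, fun y => by rw [← Real.norm_eq_abs, ← norm_iteratedFDeriv_eq_norm_iteratedDeriv]; exact hC y⟩
  choose C hC using h
  have hC0 : ∀ k, 0 ≤ C k := fun k => (abs_nonneg _).trans (hC k 0)
  refine ⟨∑ k ∈ range (n + 1), C k, Finset.sum_nonneg fun k _ => hC0 k, fun k hk y => ?_⟩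
  exact (hC k y).trans (Finset.single_le_sum (f := C) (fun k _ => hC0 k)
    (Finset.mem_range.mpr (by omega)))

theorem exists_iteratedDeriv_eq_zero {φ : ℝ → ℝ} (hφc : HasCompactSupport φ) :
    ∃ R, 0 ≤ R ∧ ∀ k y, R < |y| → iteratedDeriv k φ y = 0 := by
  obtain ⟨R, hR⟩ := hφc.isCompact.isBounded.exists_norm_le
  refine ⟨max R 0, le_max_right _ _, fun k y hy => ?_⟩
  have hy' : y ∉ tsupport φ := fun h => absurd (hR y h) (not_le.mpr ((le_max_left _ _).trans_lt hy))
  have h : iteratedFDeriv ℝ k φ y = 0 := by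
    by_contra hne
    exact hy' (support_iteratedFDeriv_subset k hne)
  rw [iteratedDeriv_eq_iteratedFDeriv, h]; rfl

theorem faaCoeff_nonneg (l : ℕ) (k : Fin l → ℕ) : 0 ≤ faaCoeff l k := by
  unfold faaCoeff; positivity

theorem sum_le_of_mem_faaIndex {l : ℕ} {k : Fin l → ℕ} (hk : k ∈ faaIndex l) : ∑ j, k j ≤ l := by
  rw [faaIndex, Finset.mem_filter] at hk
  calc ∑ j, k j ≤ ∑ j : Fin l, ((j : ℕ) + 1) * k j :=
        Finset.sum_le_sum fun j _ => Nat.le_mul_of_pos_left _ (Nat.succ_pos _)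
    _ = l := hk.2

/-- A term has `∑ k_j ≤ ∑ j k_j = l` factors, so `D ^ l` bounds their product when `D ≥ 1`. -/
theorem abs_iteratedDeriv_comp_le {g f : ℝ → ℝ} {x : ℝ} (hg : ContDiffAt ℝ ∞ g (f x))
    (hf : ContDiffAt ℝ ∞ f x) (l : ℕ) {C D : ℝ} (hC0 : 0 ≤ C) (hD1 : 1 ≤ D)
    (hC : ∀ k ≤ l, |iteratedDeriv k g (f x)| ≤ C)
    (hD : ∀ j ≤ l, |iteratedDeriv j f x| ≤ D) :
    |iteratedDeriv l (fun y => g (f y)) x| ≤ (∑ k ∈ faaIndex l, faaCoeff l k * C) * D ^ l := by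
  rw [iteratedDeriv_comp_eq_sum_faaIndex hg hf, Finset.sum_mul]
  refine (Finset.abs_sum_le_sum_abs _ _).trans (Finset.sum_le_sum fun k hk => ?_)
  have hprod : |∏ j : Fin l, iteratedDeriv ((j : ℕ) + 1) f x ^ k j| ≤ D ^ l := by
    rw [Finset.abs_prod]
    calc ∏ j : Fin l, |iteratedDeriv ((j : ℕ) + 1) f x ^ k j| ≤ ∏ j : Fin l, D ^ k j := by
          refine Finset.prod_le_prod (fun _ _ => abs_nonneg _) fun j _ => ?_
          rw [abs_pow]
          exact pow_le_pow_left₀ (abs_nonneg _) (hD _ j.2) _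
      _ = D ^ ∑ j, k j := Finset.prod_pow_eq_pow_sum _ _ _
      _ ≤ D ^ l := pow_le_pow_right₀ hD1 (sum_le_of_mem_faaIndex hk)
  rw [abs_mul, abs_mul, abs_of_nonneg (faaCoeff_nonneg l k)]
  have := faaCoeff_nonneg l k
  gcongr
  exact hC _ (sum_le_of_mem_faaIndex hk)

theorem iteratedDeriv_comp_eq_zero {g f : ℝ → ℝ} {x : ℝ} (hg : ContDiffAt ℝ ∞ g (f x))
    (hf : ContDiffAt ℝ ∞ f x) (l : ℕ) (h : ∀ k, iteratedDeriv k g (f x) = 0) :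
    iteratedDeriv l (fun y => g (f y)) x = 0 := by
  rw [iteratedDeriv_comp_eq_sum_faaIndex hg hf]
  simp [h]

/-! ### The response function -/

section Response

variable {lam₁ lam₂ : ℝ}

theorem ratio_mul_lt_one {ε : ℝ} (h : (lam₁ + ε) * lam₂ < 1) :
    ratio lam₁ lam₂ ε 0 * ratio lam₁ lam₂ ε 1 < 1 := by
  simpa [ratio] using h

theorem existsUnique_isStationary {ε : ℝ} (h₂ : 0 < lam₂) (hε : 0 < lam₁ + ε)
    (hmul : (lam₁ + ε) * lam₂ < 1) (d : Fin 2 → ℝ) :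
    ∃! μ : Measure ℝ, IsStationary (ratio lam₁ lam₂ ε) d μ :=
  ⟨_, isStationary_map_proj (ratio_pos hε h₂) (ratio_mul_lt_one hmul) d, fun _ h =>
    h.eq_map_proj (ratio_pos hε h₂) (ratio_mul_lt_one hmul)⟩

theorem response_eq_integral {ε : ℝ} (h₂ : 0 < lam₂) (hε : 0 < lam₁ + ε)
    (hmul : (lam₁ + ε) * lam₂ < 1) (d : Fin 2 → ℝ) {φ : ℝ → ℝ} (hφ : Continuous φ) :
    response lam₁ lam₂ d φ ε = ∫ w, φ (X lam₁ lam₂ d ε w) ∂wordMeasure := by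
  rw [response, stationaryMeasure_eq_map_proj (ratio_pos hε h₂) (ratio_mul_lt_one hmul),
    integral_map (aemeasurable_proj (ratio_pos hε h₂) (ratio_mul_lt_one hmul) d)
      hφ.aestronglyMeasurable]
  rfl

theorem aestronglyMeasurable_comp_X {ε : ℝ} (h₂ : 0 < lam₂) (hε : 0 < lam₁ + ε)
    (hmul : (lam₁ + ε) * lam₂ < 1) (d : Fin 2 → ℝ) {φ : ℝ → ℝ} (hφ : Continuous φ) :
    AEStronglyMeasurable (fun w => φ (X lam₁ lam₂ d ε w)) wordMeasure :=
  hφ.comp_aestronglyMeasurable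
    (aemeasurable_proj (ratio_pos hε h₂) (ratio_mul_lt_one hmul) d).aestronglyMeasurable

/-- Almost every word has summable products of ratios for all admissible parameters. -/
theorem ae_forall_summable_wordRatio (h₂ : 0 < lam₂) :
    ∀ᵐ w ∂wordMeasure, ∀ ε : ℝ, 0 < lam₁ + ε → (lam₁ + ε) * lam₂ < 1 →
      Summable (wordRatio (ratio lam₁ lam₂ ε) w) := by
  -- Rational parameters keep the exceptional set null; monotonicity in `ε` then covers each real
  -- `ε` by a larger admissible rational.
  have h : ∀ q : ℚ, ∀ᵐ w ∂wordMeasure, 0 < lam₁ + q → (lam₁ + q) * lam₂ < 1 →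
      HasGeometricDecay (ratio lam₁ lam₂ q) w := by
    intro q
    by_cases hq : 0 < lam₁ + q ∧ (lam₁ + q) * lam₂ < 1
    · filter_upwards [ae_hasGeometricDecay (ratio_pos hq.1 h₂) (ratio_mul_lt_one hq.2)] with w hw _ _
      exact hw
    · exact Filter.Eventually.of_forall fun w h1 h2 => absurd ⟨h1, h2⟩ hq
  filter_upwards [ae_all_iff.mpr h] with w hw ε hε hmul
  have hlt : ε < lam₂⁻¹ - lam₁ := by
    rw [← lt_div_iff₀ h₂, one_div] at hmul
    linarith
  obtain ⟨q, hq1, hq2⟩ := exists_rat_btwn hlt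
  have hq3 : (lam₁ + q) * lam₂ < 1 := by
    rw [← lt_div_iff₀ h₂, one_div]
    linarith
  exact ((hw q (by linarith) hq3).mono (ratio_pos hε h₂) (ratio_le hq1.le)).summable (ratio_pos hε h₂)

theorem exists_greater_admissible (h₂ : 0 < lam₂) {ε : ℝ} (hmul : (lam₁ + ε) * lam₂ < 1) :
    ∃ ε', ε < ε' ∧ (lam₁ + ε') * lam₂ < 1 := by
  have hlt : ε < lam₂⁻¹ - lam₁ := by
    rw [← lt_div_iff₀ h₂, one_div] at hmul
    linarith
  obtain ⟨q, hq1, hq2⟩ := exists_between hlt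
  refine ⟨q, hq1, ?_⟩
  rw [← lt_div_iff₀ h₂, one_div]
  linarith

/-- The derivatives of `φ (X ε)` are dominated by an integrable function, uniformly in `ε` in a
neighbourhood of `0`. -/
theorem exists_dominating (h_pos : 0 < lam₁) (h_gt : 1 < lam₂) (h_mul : lam₁ * lam₂ < 1)
    {d : Fin 2 → ℝ} (h_fix : ¬ ∃ x : ℝ, lam₁ * x + d 0 = x ∧ lam₂ * x + d 1 = x)
    {φ : ℝ → ℝ} (hφ : ContDiff ℝ ∞ φ) (hφc : HasCompactSupport φ) :
    ∃ δ > 0, (∀ ε ∈ Metric.ball (0 : ℝ) δ, 0 < lam₁ + ε ∧ (lam₁ + ε) * lam₂ < 1) ∧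
      ∀ n : ℕ, ∃ g : Words → ℝ, Integrable g wordMeasure ∧ ∀ᵐ w ∂wordMeasure,
        ∀ ε ∈ Metric.ball (0 : ℝ) δ,
          |iteratedDeriv n (fun ε => φ (X lam₁ lam₂ d ε w)) ε| ≤ g w := by
  have h₂ : 0 < lam₂ := by linarith
  obtain ⟨ε', hε'0, hε'⟩ := exists_greater_admissible (ε := 0) h₂ (by simpa using h_mul)
  set p₂ := d 1 / (1 - lam₂) with hp₂
  have hne : 1 - lam₂ ≠ 0 := by linarith
  -- `c ε` is the defect of `p₂`, the fixed point of the expanding map, from being fixed by the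
  -- other map.
  set c : ℝ → ℝ := fun ε => p₂ * (1 - (lam₁ + ε)) - d 0 with hc
  have hc0 : c 0 ≠ 0 := by
    intro h0
    refine h_fix ⟨p₂, ?_, ?_⟩
    · simp only [hc, add_zero] at h0; linarith
    · rw [hp₂]; field_simp; ring
  have hcont : Continuous fun ε => |c ε| := by fun_prop
  have hev : ∀ᶠ ε in nhds (0 : ℝ), lam₁ / 2 < lam₁ + ε ∧ ε < ε' ∧ |c 0| / 2 < |c ε| := by
    refine Filter.Eventually.and ?_ (Filter.Eventually.and (gt_mem_nhds hε'0) ?_)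
    · exact (continuous_const.add continuous_id).continuousAt.eventually_const_lt
        (by simpa using half_lt_self h_pos)
    · exact hcont.continuousAt.eventually_const_lt (half_lt_self (abs_pos.mpr hc0))
  obtain ⟨δ, hδ, hball⟩ := Metric.eventually_nhds_iff_ball.mp hev
  -- `δ` is chosen before `n`, so one neighbourhood serves all orders of differentiation.
  refine ⟨δ, hδ, fun ε hε => ?_, fun n => ?_⟩
  · obtain ⟨h1, h2, -⟩ := hball ε hε
    exact ⟨by linarith, lt_trans (by gcongr) hε'⟩
  have hpos' : 0 < lam₁ + ε' := by linarith
  obtain ⟨s, q, V, hs0, hs1, hq0, hq1, hVint, hV⟩ :=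
    exists_integrable_bound (ratio_pos hpos' h₂) (ratio_mul_lt_one hε')
  obtain ⟨C, hC0, hC⟩ := exists_bound_iteratedDeriv hφ hφc n
  obtain ⟨R₀, hR₀, hzero⟩ := exists_iteratedDeriv_eq_zero hφc
  set R := max 1 ((|p₂| + R₀) / (|c 0| / 2)) with hR
  have hR1 : 1 ≤ R := le_max_left _ _
  -- At most `n` factors of size `V ^ t` must stay below `V ≥ 1`; `n + 1` in place of `n` also
  -- covers `n = 0`.
  set t : ℝ := (((n + 1 : ℕ) : ℝ))⁻¹ with ht
  have ht0 : 0 < t := by positivity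
  set K : ℕ → ℝ := fun j => (j.factorial : ℝ) / (lam₁ / 2) ^ j *
    (∑' m : ℕ, (m : ℝ) ^ j * (q ^ t) ^ m) * (∑ i, |d i|) * R with hK
  have hK0 : ∀ j, 0 ≤ K j := fun j => by
    have : 0 ≤ ∑' m : ℕ, (m : ℝ) ^ j * (q ^ t) ^ m := tsum_nonneg fun m => by positivity
    positivity
  set M := 1 + ∑ j ∈ range (n + 1), K j with hM
  have hM1 : 1 ≤ M := le_add_of_nonneg_right (Finset.sum_nonneg fun j _ => hK0 j)
  have hKM : ∀ j ≤ n, K j ≤ M := fun j hj =>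
    (Finset.single_le_sum (f := K) (fun j _ => hK0 j) (Finset.mem_range.mpr (by omega))).trans
      (le_add_of_nonneg_left zero_le_one)
  have hA0 : 0 ≤ ∑ k ∈ faaIndex n, faaCoeff n k * C :=
    Finset.sum_nonneg fun k _ => mul_nonneg (faaCoeff_nonneg n k) hC0
  refine ⟨fun w => ((∑ k ∈ faaIndex n, faaCoeff n k * C) * M ^ n) * V w, hVint.const_mul _, ?_⟩
  filter_upwards [hV, ae_summable_wordRatio (ratio_pos hpos' h₂) (ratio_mul_lt_one hε')]
    with w ⟨hV1, hVw⟩ hsum' ε hε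
  obtain ⟨h1, h2, h3⟩ := hball ε hε
  have hε0 : 0 < lam₁ + ε := by linarith
  have hV0 : 0 ≤ V w := zero_le_one.trans hV1
  have hX : ContDiffAt ℝ ∞ (fun ε => X lam₁ lam₂ d ε w) ε := contDiffAt_X h₂ hε0 h2 hsum'
  have hpos := ratio_pos hε0 h₂
  have hle := wordRatio_mono hpos (ratio_le (lam₁ := lam₁) (lam₂ := lam₂) h2.le) w
  have hsum : Summable (wordRatio (ratio lam₁ lam₂ ε) w) :=
    Summable.of_nonneg_of_le (fun m => (wordRatio_pos hpos w m).le) hle hsum'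
  rcases lt_or_ge R₀ |X lam₁ lam₂ d ε w| with hlarge | hsmall
  · rw [iteratedDeriv_comp_eq_zero hφ.contDiffAt hX n fun k => hzero k _ hlarge, abs_zero]
    positivity
  have hPR : ∀ m, wordRatio (ratio lam₁ lam₂ ε) w m ≤ R := by
    intro m
    have h := wordRatio_le_of_proj (d := d) hpos (by simpa [ratio] using h_gt) hsum
      (by
        have : c ε ≠ 0 := abs_pos.mp ((half_pos (abs_pos.mpr hc0)).trans h3)
        simpa [ratio, hc, hp₂] using this) m
    refine h.trans (le_trans ?_ (le_max_right _ _))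
    have e1 : |d 1 / (1 - ratio lam₁ lam₂ ε 1) - proj (ratio lam₁ lam₂ ε) d w| ≤ |p₂| + R₀ := by
      refine (abs_sub _ _).trans (add_le_add (by simp [ratio, hp₂]) hsmall)
    have e2 : |c 0| / 2 ≤ |d 1 / (1 - ratio lam₁ lam₂ ε 1) * (1 - ratio lam₁ lam₂ ε 0) - d 0| := by
      refine h3.le.trans_eq ?_
      simp [ratio, hc, hp₂]
    have hhalf : 0 < |c 0| / 2 := half_pos (abs_pos.mpr hc0)
    gcongr
  have hgeo : ∀ m, wordRatio (ratio lam₁ lam₂ ε) w m ≤ R * V w ^ t * (q ^ t) ^ m := fun m =>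
    le_mul_rpow_of_rpow_le (wordRatio_pos hpos w m) (hPR m) hR1 hs0 hs1 hV0 hq0.le
      ((Real.rpow_le_rpow (wordRatio_pos hpos w m).le (hle m) hs0.le).trans (hVw m))
      (Nat.succ_le_succ (Nat.zero_le n))
  have hVt1 : 1 ≤ V w ^ t := Real.one_le_rpow hV1 ht0.le
  have hD : ∀ j ≤ n, |iteratedDeriv j (fun ε => X lam₁ lam₂ d ε w) ε| ≤ M * V w ^ t := by
    intro j hj
    refine (abs_iteratedDeriv_X_le h₂ (half_pos h_pos) h1.le h2 hsum' (by positivity)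
      (Real.rpow_lt_one hq0.le hq1 ht0) hgeo j).trans ?_
    calc _ = K j * V w ^ t := by rw [hK]; ring
      _ ≤ M * V w ^ t := by gcongr; exact hKM j hj
  refine (abs_iteratedDeriv_comp_le hφ.contDiffAt hX n hC0 (one_le_mul_of_one_le_of_one_le hM1 hVt1)
    (fun k hk => hC k hk _) hD).trans ?_
  rw [mul_pow, ← mul_assoc]
  gcongr
  calc (V w ^ t) ^ n ≤ (V w ^ t) ^ (n + 1) := pow_le_pow_right₀ hVt1 (Nat.le_succ n)
    _ = V w := Real.rpow_inv_natCast_pow hV0 (Nat.succ_ne_zero n)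

end Response

end

end LinearResponse

/-! ### Assembly of the main theorem -/

theorem mainTheorem1 (lam₁ lam₂ : ℝ) (h_pos : 0 < lam₁) (h_lt : lam₁ < 1) (h_gt : 1 < lam₂)
    (h_mul : lam₁ * lam₂ < 1) (d : Fin 2 → ℝ)
    (h_fix : ¬ ∃ x : ℝ, lam₁ * x + d 0 = x ∧ lam₂ * x + d 1 = x)
    (φ : ℝ → ℝ) (hφ : ContDiff ℝ ∞ φ) (hφc : HasCompactSupport φ) :
    -- the stationary measures and the random variables `X(ε)`, `X^{(j)}` are well defined
    (∀ ε : ℝ, 0 < lam₁ + ε → (lam₁ + ε) * lam₂ < 1 →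
      ∃! μ : Measure ℝ, LinearResponse.IsStationary (LinearResponse.ratio lam₁ lam₂ ε) d μ) ∧
    (∀ᵐ w ∂LinearResponse.wordMeasure,
      (∀ ε : ℝ, 0 < lam₁ + ε → (lam₁ + ε) * lam₂ < 1 →
        Summable fun m : ℕ =>
          LinearResponse.wordRatio (LinearResponse.ratio lam₁ lam₂ ε) w m * d (w m)) ∧
      ContDiffAt ℝ ∞ (fun ε => LinearResponse.X lam₁ lam₂ d ε w) 0 ∧
      ∀ j : ℕ, 1 ≤ j →
        HasSum (fun m : ℕ => (j.factorial : ℝ) / lam₁ ^ j *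
            (LinearResponse.wordRatio (LinearResponse.ratio lam₁ lam₂ 0) w m *
              ((LinearResponse.onesCount w m).choose j : ℝ) * d (w m)))
          (LinearResponse.XDeriv lam₁ lam₂ d j w)) ∧
    -- infinite differentiability at `0` and the formula for the derivatives
    ContDiffAt ℝ ∞ (LinearResponse.response lam₁ lam₂ d φ) 0 ∧
    ∀ l : ℕ,
      Integrable (fun w => iteratedDeriv l (fun ε => φ (LinearResponse.X lam₁ lam₂ d ε w)) 0)
        LinearResponse.wordMeasure ∧
      iteratedDeriv l (LinearResponse.response lam₁ lam₂ d φ) 0 =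
        ∫ w, iteratedDeriv l (fun ε => φ (LinearResponse.X lam₁ lam₂ d ε w)) 0
          ∂LinearResponse.wordMeasure ∧
      Integrable (LinearResponse.formalDeriv lam₁ lam₂ d φ l) LinearResponse.wordMeasure ∧
      ∫ w, iteratedDeriv l (fun ε => φ (LinearResponse.X lam₁ lam₂ d ε w)) 0
          ∂LinearResponse.wordMeasure =
        ∫ w, LinearResponse.formalDeriv lam₁ lam₂ d φ l w ∂LinearResponse.wordMeasure := by

  have h₂ : 0 < lam₂ := by linarith
  obtain ⟨δ, hδ, hadm, hdom⟩ :=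
    LinearResponse.exists_dominating h_pos h_gt h_mul h_fix hφ hφc
  have hae := LinearResponse.ae_forall_summable_wordRatio (lam₁ := lam₁) h₂
  have hX : ∀ᵐ w ∂LinearResponse.wordMeasure, ∀ ε ∈ Metric.ball (0 : ℝ) δ,
      ContDiffAt ℝ ∞ (fun ε => LinearResponse.X lam₁ lam₂ d ε w) ε := by
    filter_upwards [hae] with w hw ε hε
    obtain ⟨ε', h1, h2⟩ := LinearResponse.exists_greater_admissible h₂ (hadm ε hε).2
    exact LinearResponse.contDiffAt_X h₂ (hadm ε hε).1 h1 (hw ε' (by linarith [(hadm ε hε).1]) h2)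
  have h0 : (0 : ℝ) ∈ Metric.ball (0 : ℝ) δ := Metric.mem_ball_self hδ
  have hm : ∀ ε ∈ Metric.ball (0 : ℝ) δ, AEStronglyMeasurable
      (fun w => φ (LinearResponse.X lam₁ lam₂ d ε w)) LinearResponse.wordMeasure := fun ε hε =>
    LinearResponse.aestronglyMeasurable_comp_X h₂ (hadm ε hε).1 (hadm ε hε).2 d hφ.continuous
  have hd : ∀ᵐ w ∂LinearResponse.wordMeasure, ∀ ε ∈ Metric.ball (0 : ℝ) δ,
      ContDiffAt ℝ ∞ (fun ε => φ (LinearResponse.X lam₁ lam₂ d ε w)) ε :=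
    hX.mono fun w hw ε hε => hφ.contDiffAt.comp ε (hw ε hε)
  -- The representation holds on a neighbourhood of `0`, which suffices to transfer smoothness and
  -- all derivatives at `0`.
  have hresp : LinearResponse.response lam₁ lam₂ d φ =ᶠ[nhds 0] fun ε =>
      ∫ w, φ (LinearResponse.X lam₁ lam₂ d ε w) ∂LinearResponse.wordMeasure := by
    filter_upwards [Metric.ball_mem_nhds 0 hδ] with ε hε
    exact LinearResponse.response_eq_integral h₂ (hadm ε hε).1 (hadm ε hε).2 d hφ.continuous
  have hfaa : ∀ l, (fun w => iteratedDeriv l (fun ε => φ (LinearResponse.X lam₁ lam₂ d ε w)) 0)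
      =ᵐ[LinearResponse.wordMeasure] LinearResponse.formalDeriv lam₁ lam₂ d φ l := fun l =>
    hX.mono fun w hw =>
      LinearResponse.iteratedDeriv_comp_eq_sum_faaIndex hφ.contDiffAt (hw 0 h0) l
  refine ⟨fun ε hε hmul => LinearResponse.existsUnique_isStationary h₂ hε hmul d, ?_, ?_, ?_⟩
  · filter_upwards [hae, hX] with w hw hXw
    refine ⟨fun ε hε hmul => LinearResponse.summable_mul_of_summable_wordRatio (hw ε hε hmul)
      (LinearResponse.ratio_pos hε h₂) d, hXw 0 h0, fun j _ => ?_⟩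
    obtain ⟨ε', h1, h2⟩ := LinearResponse.exists_greater_admissible h₂ (hadm 0 h0).2
    have h := LinearResponse.hasSum_iteratedDeriv_X (d := d) h₂ (hadm 0 h0).1 h1
      (hw ε' (by linarith) h2) j
    rw [add_zero] at h
    exact h
  · exact ((LinearResponse.contDiffOn_integral Metric.isOpen_ball hm hd hdom).contDiffAt
      (Metric.ball_mem_nhds 0 hδ)).congr_of_eventuallyEq hresp
  · intro l
    have hint := LinearResponse.integrable_iteratedDeriv Metric.isOpen_ball hm hd hdom l h0
    refine ⟨hint, ?_, hint.congr (hfaa l), integral_congr_ae (hfaa l)⟩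
    rw [hresp.iteratedDeriv_eq l]
    exact LinearResponse.iteratedDeriv_integral Metric.isOpen_ball hm hd hdom l 0 h0
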